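/- Let $d\ge 0$ be an integer and let $\varphi:\mathbb Z_{\ge 0}\to[0,\infty)$ satisfy $\sum_{i\in\mathbb Z^d}\varphi(\rho(0,i))<\infty$, where $\rho(k,i)=\max_\nu|k_\nu-i_\nu|$ and $\rho(k,M)=\min_{i\in M}\rho(k,i)$. *Setting.* Let $\mathcal X$ be a finite set. A compatible ensemble of conditional distributions on $\mathcal X^{\mathbb Z^d}$ assigns to every finite $\Lambda\subset\mathbb Z^d$ and every outside configuration $\bar x_\Lambda=(x_i)_{i\notin\Lambda}$ a probability measure $q_\Lambda(\cdot|\bar x_\Lambda)$ on $\mathcal X^\Lambda$ such that $q_\Lambda(x_\Lambda|\bar x_\Lambda)=q_{\Lambda\setminus M}(x_{\Lambda\setminus M}|\bar x_\Lambda)\,q_M(x_M|\bar x_M)$ for all $M\subset\Lambda$ and all $x\in\mathcal X^{\mathbb Z^d}$; here, for $N\subset\Lambda$, $q_N(\cdot|\bar x_\Lambda)$ denotes the marginal of $q_\Lambda(\cdot|\bar x_\Lambda)$ on $\mathcal X^N$. For an integer $l\ge1$ let $\mathcal C_l$ be the set of finite unions of $l$-sided cubes $\prod_\nu\{v_\nu,\dots,v_\nu+l-1\}$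 with $v\in l\mathbb Z^d$. The ensemble is strongly mixing over $\mathcal C_l$ with coupling function $\varphi$ if $|q_M(\cdot|\bar y_\Lambda)-q_M(\cdot|\bar z_\Lambda)|\le\varphi(\rho(k,M))$ for all $\Lambda\in\mathcal C_l$, all nonempty $M\subset\Lambda$, and all outside configurations $\bar y_\Lambda,\bar z_\Lambda$ differing only at a single site $k\notin\Lambda$, where $|r-s|=\sup_A|r(A)-s(A)|$ is the variational distance. For probability measures $r,s$ on $\mathcal X^{\Lambda}$ put $$W_2(r,s)=\min_\pi\Big(\sum_{i\in\Lambda}\mathrm{Pr}_\pi\{Z_i\ne U_i\}^2\Big)^{1/2},$$ the minimum being over all couplings $\pi=\mathcal L(Z,U)$ of $r$ and $s$. *Claim.* There are $m_0$ and $C>0$, depending only on $d$ and $\varphi$, such that the following holds for all integers $m\ge m_0$ and $l\ge1$, every finite set $\mathcal X$ and every compatible ensemble on $\mathcal X^{\mathbb Z^d}$ that is strongly mixing over $\mathcal C_l$ with coupling function $\varphi$. Let $\Lambda\in\mathcal C_l$, let $\bar y_\Lambda$ be an outside configuration, let $p_\Lambda=\mathcal L(Y_\Lambda)$ be any probability measure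 on $\mathcal X^\Lambda$, and extend $Y_\Lambda$ to $\mathbb Z^d$ by $\bar Y_\Lambda=\bar y_\Lambda$. Let $\mathcal I_{ml}$ be the set of $ml$-sided cubes (cubes of $(ml)^d$ sites) that belong to $\mathcal C_l$ and intersect $\Lambda$. With $p_{M}(\cdot|\bar Y_{M})$ denoting the conditional law of $Y_{M}$ given $\bar Y_M=(Y_i)_{i\notin M}$, $$W_2^2\bigl(p_\Lambda,q_\Lambda(\cdot|\bar y_\Lambda)\bigr)\le C\sum_{I\in\mathcal I_{ml}}\mathbb E\,W_2^2\bigl(p_{I\cap\Lambda}(\cdot|\bar Y_{I\cap\Lambda}),q_{I\cap\Lambda}(\cdot|\bar Y_{I\cap\Lambda})\bigr)\le C\,(ml)^d\sum_{I\in\mathcal I_{ml}}\mathbb E\,\bigl|p_{I\cap\Lambda}(\cdot|\bar Y_{I\cap\Lambda})-q_{I\cap\Lambda}(\cdot|\bar Y_{I\cap\Lambda})\bigr|^2 .$$ -/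

import Mathlib

universe u

noncomputable section

namespace Lattice

/-! ## Distances between probability measures on finite sets -/

/-- Probability of the event `A` under `r`, as a real number. -/
def prob {α : Type*} (r : PMF α) (A : Set α) : ℝ := (r.toOuterMeasure A).toReal

/-- Variational distance `|r - s| = sup_A |r(A) - s(A)|`. -/
def tv {α : Type*} (r s : PMF α) : ℝ := ⨆ A : Set α, |prob r A - prob s A|

/-- `π` is a coupling of `r` and `s`. -/
def IsCoupling {α : Type*} (π : PMF (α × α)) (r s : PMF α) : Prop :=
  π.map Prod.fst = r ∧ π.map Prod.snd = s

/-- `W₂(r, s)`: the least value of `(∑ i, Pr_π{Z_i ≠ U_i}²)^{1/2}` over all couplings `π = law(Z, U)`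
of `r` and `s`. -/
def W2 {ι : Type*} {X : Type*} [Fintype ι] (r s : PMF (ι → X)) : ℝ :=
  sInf {c : ℝ | ∃ π : PMF ((ι → X) × (ι → X)), IsCoupling π r s ∧
    c = √(∑ i, prob π {z | z.1 i ≠ z.2 i} ^ 2)}

/-! ## The lattice and unions of cubes -/

/-- Sites of the lattice `ℤ^d`. -/
abbrev Site (d : ℕ) : Type := Fin d → ℤ

/-- The distance `ρ(k, i) = max_ν |k_ν - i_ν|`. -/
def rho {d : ℕ} (k i : Site d) : ℕ := Finset.univ.sup fun ν => (k ν - i ν).natAbs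

/-- The distance `ρ(k, M)` from a site to a nonempty finite set of sites. -/
def rhoSet {d : ℕ} (k : Site d) (M : Finset (Site d)) (hM : M.Nonempty) : ℕ := M.inf' hM (rho k)

/-- The cube with lowest vertex `v` and side `s`, consisting of `s ^ d` sites. -/
def cube {d : ℕ} (v : Site d) (s : ℕ) : Finset (Site d) :=
  Fintype.piFinset fun ν => Finset.Ico (v ν) (v ν + s)

/-- The class `C_l` of finite unions of `l`-sided cubes with vertices in the sublattice `l ℤ^d`. -/
def cubeUnions (d l : ℕ) : Set (Finset (Site d)) :=
  {Λ | ∃ S : Finset (Site d), Λ = S.biUnion fun a => cube ((l : ℤ) • a) l}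

/-- The `m * l`-sided cubes that belong to `C_l` and intersect `Λ`. -/
def coveringCubeSet {d : ℕ} (m l : ℕ) (Λ : Finset (Site d)) : Set (Finset (Site d)) :=
  {I | (∃ v : Site d, I = cube v (m * l)) ∧ I ∈ cubeUnions d l ∧ (I ∩ Λ).Nonempty}

theorem coveringCubeSet_finite {d : ℕ} (m l : ℕ) (Λ : Finset (Site d)) :
    (coveringCubeSet m l Λ).Finite := by
  classical
  refine Set.Finite.subset (Λ.biUnion fun i =>
    (Finset.Icc (fun ν => i ν - ((m * l : ℕ) : ℤ)) i).image fun v => cube v (m * l)).finite_toSet ?_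
  rintro I ⟨⟨v, rfl⟩, -, i, hi⟩
  rw [Finset.mem_inter] at hi
  have h := hi.1
  simp only [cube, Fintype.mem_piFinset, Finset.mem_Ico] at h
  simp only [Finset.coe_biUnion, Set.mem_iUnion, Finset.mem_coe, Finset.mem_image, Finset.mem_Icc]
  refine ⟨i, hi.2, v, ⟨fun ν => ?_, fun ν => (h ν).1⟩, rfl⟩
  have := (h ν).2
  show i ν - ((m * l : ℕ) : ℤ) ≤ v ν
  omega

/-- The finite family `I_{ml}` of `m * l`-sided cubes from `C_l` that intersect `Λ`. -/
def coveringCubes {d : ℕ} (m l : ℕ) (Λ : Finset (Site d)) : Finset (Finset (Site d)) :=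
  (coveringCubeSet_finite m l Λ).toFinset

/-! ## Marginals, conditional laws, ensembles of conditional distributions -/

/-- The marginal on `M ⊆ Λ` of a probability measure on `X^Λ`. -/
def marginal {d : ℕ} {X : Type*} {M Λ : Finset (Site d)} (h : M ⊆ Λ) (p : PMF (Λ → X)) :
    PMF (M → X) :=
  p.map (Finset.restrict₂ (π := fun _ => X) h)

open Classical in
/-- For `p = law(Y)` on `X^Λ` and `M ⊆ Λ`, the conditional law of `Y_M` given that `Y` agrees with
`z` on `Λ \ M`. If this event has probability zero the value is irrelevant, and is set to be the
marginal of `p` on `M`. -/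
def condLaw {d : ℕ} {X : Type*} {M Λ : Finset (Site d)} (h : M ⊆ Λ) (p : PMF (Λ → X))
    (z : Λ → X) : PMF (M → X) :=
  if hz : ∃ w ∈ {w : Λ → X | ∀ i : Λ, i.1 ∉ M → w i = z i}, w ∈ p.support then
    marginal h (p.filter {w : Λ → X | ∀ i : Λ, i.1 ∉ M → w i = z i} hz)
  else marginal h p

/-- The configuration on `ℤ^d` that equals `z` on `Λ` and `y` outside `Λ`. -/
def glue {d : ℕ} {X : Type*} (Λ : Finset (Site d)) (z : Λ → X) (y : Site d → X) : Site d → X :=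
  fun i => if h : i ∈ Λ then z ⟨i, h⟩ else y i

/-- The expectation of `f(Y)` for `Y` with law `p` on a finite set. -/
def expect {α : Type*} [Fintype α] (p : PMF α) (f : α → ℝ) : ℝ := ∑ z, (p z).toReal * f z

/-- A compatible ensemble of conditional distributions `q_Λ(· | x̄_Λ)`, for finite `Λ ⊂ ℤ^d`. The
outside configuration is given as a configuration on all of `ℤ^d`, whose restriction to `Λ` does not
matter. -/
structure Specification (d : ℕ) (X : Type u) where
  /-- The measure `q_Λ(· | x̄_Λ)` on `X^Λ`. -/
  law : (Λ : Finset (Site d)) → (Site d → X) → PMF (Λ → X)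
  law_congr : ∀ (Λ : Finset (Site d)) (x y : Site d → X),
    (∀ i, i ∉ Λ → x i = y i) → law Λ x = law Λ y
  /-- For `M ⊆ Λ`, `q_Λ(x_Λ | x̄_Λ) = q_{Λ \ M}(x_{Λ \ M} | x̄_Λ) * q_M(x_M | x̄_M)`. -/
  compat : ∀ (M Λ : Finset (Site d)), M ⊆ Λ → ∀ x : Site d → X,
    law Λ x (Λ.restrict x) =
      marginal (Finset.sdiff_subset : Λ \ M ⊆ Λ) (law Λ x) ((Λ \ M).restrict x) *
        law M x (M.restrict x)

/-- Strong mixing over `C_l` with coupling function `φ`: if `M ⊆ Λ ∈ C_l` and the outside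
configurations `y`, `z` differ only at the site `k ∉ Λ`, then
`|q_M(· | ȳ_Λ) - q_M(· | z̄_Λ)| ≤ φ(ρ(k, M))`. -/
def Specification.StronglyMixingOver {d : ℕ} {X : Type u} (q : Specification d X) (l : ℕ)
    (φ : ℕ → ℝ) : Prop :=
  ∀ Λ ∈ cubeUnions d l, ∀ (M : Finset (Site d)) (hM : M ⊆ Λ) (hne : M.Nonempty),
    ∀ k, k ∉ Λ → ∀ y z : Site d → X, (∀ i, i ∉ Λ → i ≠ k → y i = z i) →
      tv (marginal hM (q.law Λ y)) (marginal hM (q.law Λ z)) ≤ φ (rhoSet k M hne)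

/-- `E W₂²(p_{I∩Λ}(· | Ȳ_{I∩Λ}), q_{I∩Λ}(· | Ȳ_{I∩Λ}))`, where `Y_Λ` has law `p` and `Y` equals `y`
outside `Λ`. -/
def expectW2Sq {d : ℕ} {X : Type u} [Fintype X] (q : Specification d X) (Λ : Finset (Site d))
    (y : Site d → X) (p : PMF (Λ → X)) (I : Finset (Site d)) : ℝ :=
  expect p fun z =>
    W2 (condLaw (Finset.inter_subset_right : I ∩ Λ ⊆ Λ) p z) (q.law (I ∩ Λ) (glue Λ z y)) ^ 2

/-- `E |p_{I∩Λ}(· | Ȳ_{I∩Λ}) - q_{I∩Λ}(· | Ȳ_{I∩Λ})|²`, where `Y_Λ` has law `p` and `Y` equals `y`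
outside `Λ`. -/
def expectTvSq {d : ℕ} {X : Type u} [Fintype X] (q : Specification d X) (Λ : Finset (Site d))
    (y : Site d → X) (p : PMF (Λ → X)) (I : Finset (Site d)) : ℝ :=
  expect p fun z =>
    tv (condLaw (Finset.inter_subset_right : I ∩ Λ ⊆ Λ) p z) (q.law (I ∩ Λ) (glue Λ z y)) ^ 2

end Lattice

end

/-!
A Gibbs sampler argument. Everything lives on finite sets, so probability measures are handled as
real weights, and the object that is manipulated is the vector of site by site disagreements of a
coupling (`disag`, `Coupled`): it adds up along compositions of couplings (`Coupled.trans`) and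
averages along mixtures (`Coupled.mix`).

Take an optimal coupling of `p` and `q_Λ(· | ȳ_Λ)`, with disagreements `Δ`, and a cube `I`. Resample the
sites of `I ∩ Λ` from the conditional laws of `p` in the first variable and from the ensemble in the
second. Both laws are preserved, so the result is another coupling of the same two measures. At the
sites outside `I` it disagrees as before. At a site `i` of `I ∩ Λ` it disagrees with probability at
most `E_I(i) + ∑ φ(ρ(k, i)) Δ_k`, the sum being over the sites `k` of `Λ` outside `I`, where `E_I` is
the error of replacing the conditional law of `p` by that of the ensemble, with
`∑_i E_I(i)² ≤ E W₂²(p_{I∩Λ}, q_{I∩Λ})` (`Specification.StronglyMixingOver.exists_resample`).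

Strong mixing controls the law of the configuration at distance at least `r` from a changed site, for
each `r` separately, whereas the sum above needs one coupling that is good at all sites. Such a
coupling exists because these marginals form a chain: a coupling that is maximal for a marginal lifts
to one that is maximal for the next (`Couples.lift`, `coupled_of_height`).

Now average over the `N` cubes of the family. Each site lies in exactly `n = m ^ d` of them, and at
most a fraction `d ρ(k, i) / m` of the cubes containing `i` miss `k`. Summability of `φ` and dominated
convergence make the resulting matrix of influences have row sums at most `1 / 2` for large `m`
(`exists_influence_le`), so by Schur's test its norm is at most `1 / 2`. Since the original coupling
was optimal, convexity of the square gives, with `θ = n / N` and `W` the distance,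
`W² ≤ (1 - θ) W² + θ (W² / 2 + 2 ∑_I E W₂²(p_{I∩Λ}, q_{I∩Λ}))`, and the factor `θ` cancels. The
second inequality is the bound of `W₂²` by the number of sites times the squared variational distance,
which a maximal coupling provides.
-/

namespace Lattice

open Finset

/-! ### Couplings of weights on a finite type -/

/-- The push-forward of the weight `r` under `f`. -/
def push {α β : Type*} [Fintype α] [DecidableEq β] (f : α → β) (r : α → ℝ) (b : β) : ℝ :=
  ∑ a, if f a = b then r a else 0

/-- `π` is a nonnegative weight on pairs with marginals `r` and `s`. The common total mass need not
be one. -/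
structure Couples {α : Type*} [Fintype α] (r s : α → ℝ) (π : α → α → ℝ) : Prop where
  nonneg : ∀ a a', 0 ≤ π a a'
  fst : ∀ a, ∑ a', π a a' = r a
  snd : ∀ a', ∑ a, π a a' = s a'

section Push

variable {α β γ δ κ : Type*} [Fintype α]

theorem push_nonneg [DecidableEq β] (f : α → β) {r : α → ℝ} (hr : ∀ a, 0 ≤ r a) (b : β) :
    0 ≤ push f r b :=
  sum_nonneg fun a _ => by split_ifs <;> simp [hr]

theorem push_mono [DecidableEq β] (f : α → β) {r s : α → ℝ} (h : ∀ a, r a ≤ s a) (b : β) :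
    push f r b ≤ push f s b :=
  sum_le_sum fun a _ => by split_ifs <;> simp [h]

theorem push_sub [DecidableEq β] (f : α → β) (r s : α → ℝ) (b : β) :
    push f (fun a => r a - s a) b = push f r b - push f s b := by
  simp only [push, ← sum_sub_distrib]
  exact sum_congr rfl fun a _ => by split_ifs <;> simp

theorem push_add [DecidableEq β] (f : α → β) (r s : α → ℝ) (b : β) :
    push f (fun a => r a + s a) b = push f r b + push f s b := by
  simp only [push, ← sum_add_distrib]
  exact sum_congr rfl fun a _ => by split_ifs <;> simp

theorem push_ite [DecidableEq β] (f : α → β) (r : α → ℝ) (b b' : β) :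
    push f (fun a => if f a = b' then r a else 0) b = if b = b' then push f r b else 0 := by
  by_cases hb : b = b'
  · rw [if_pos hb, ← hb]
    exact sum_congr rfl fun a _ => by split_ifs <;> simp_all
  · rw [if_neg hb]
    exact sum_eq_zero fun a _ => by split_ifs <;> simp_all

theorem sum_push_comm [DecidableEq β] [Fintype κ] (f : α → β) (r : κ → α → ℝ) (b : β) :
    ∑ k, push f (r k) b = push f (fun a => ∑ k, r k a) b := by
  simp only [push]
  rw [sum_comm]
  exact sum_congr rfl fun a _ => by split_ifs <;> simp

variable [Fintype β]

theorem sum_mul_push [DecidableEq β] (f : α → β) (r : α → ℝ) (g : β → ℝ) :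
    ∑ b, g b * push f r b = ∑ a, g (f a) * r a := by
  simp only [push, mul_sum]
  rw [sum_comm]
  simp

theorem sum_push [DecidableEq β] (f : α → β) (r : α → ℝ) : ∑ b, push f r b = ∑ a, r a := by
  simpa using sum_mul_push f r fun _ => 1

theorem push_push [DecidableEq β] [DecidableEq γ] (f : α → β) (g : β → γ) (r : α → ℝ) :
    push g (push f r) = push (fun a => g (f a)) r := by
  funext c
  simpa [push] using sum_mul_push f r fun b => if g b = c then 1 else 0

theorem push_comm [DecidableEq δ] [DecidableEq γ] (f : α → γ) (g : β → δ) (w : α → β → ℝ)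
    (c : γ) (d : δ) :
    push f (fun a => push g (w a) d) c = push g (fun b => push f (fun a => w a b) c) d := by
  simp only [push]
  have h1 : ∀ a, (if f a = c then ∑ b, if g b = d then w a b else 0 else 0) =
      ∑ b, if f a = c ∧ g b = d then w a b else 0 := fun a => by
    by_cases h : f a = c <;> simp [h]
  have h2 : ∀ b, (if g b = d then ∑ a, if f a = c then w a b else 0 else 0) =
      ∑ a, if f a = c ∧ g b = d then w a b else 0 := fun b => by
    by_cases h : g b = d <;> simp [h]
  rw [sum_congr rfl fun a _ => h1 a, sum_congr rfl fun b _ => h2 b, sum_comm]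

/-- The push-forward of a weight on pairs under the map `(a, a') ↦ (f a, g a')`. -/
def push₂ [DecidableEq γ] [DecidableEq δ] (f : α → γ) (g : β → δ) (π : α → β → ℝ) (c : γ) (d : δ) :
    ℝ :=
  push f (fun a => push g (π a) d) c

theorem push₂_push₂ [DecidableEq γ] [Fintype γ] [DecidableEq κ] (f : α → γ) (g : γ → κ)
    (π : α → α → ℝ) :
    push₂ g g (push₂ f f π) = push₂ (fun a => g (f a)) (fun a => g (f a)) π := by
  funext k k'
  have h : ∀ c, push g (push₂ f f π c) k' = push f (fun a => push (fun a => g (f a)) (π a) k') c := by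
    intro c
    simp only [← push_push f g]
    exact (push_comm f g _ c k').symm
  rw [push₂, funext h, push_push, push₂]

end Push

theorem sum_push₂_mul {α : Type*} [Fintype α] {β : Type*} [Fintype β] [DecidableEq β]
    (f g : α → β) (π : α → α → ℝ) (G : β → β → ℝ) :
    ∑ b, ∑ b', G b b' * push₂ f g π b b' = ∑ a, ∑ a', G (f a) (g a') * π a a' := by
  rw [sum_comm]
  refine (sum_congr rfl fun b' _ => sum_mul_push f (fun a => push g (π a) b')
    fun b => G b b').trans ?_
  rw [sum_comm]
  exact sum_congr rfl fun a _ => sum_mul_push g (π a) (G (f a))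

namespace Couples

variable {α β : Type*} [Fintype α] [Fintype β] {r s t : α → ℝ} {π : α → α → ℝ}

theorem right_nonneg (h : Couples r s π) (a : α) : 0 ≤ s a :=
  h.snd a ▸ sum_nonneg fun _ _ => h.nonneg _ _

theorem le_left (h : Couples r s π) (a a' : α) : π a a' ≤ r a :=
  h.fst a ▸ single_le_sum (f := fun a' => π a a') (fun _ _ => h.nonneg _ _) (mem_univ a')

theorem le_right (h : Couples r s π) (a a' : α) : π a a' ≤ s a' :=
  h.snd a' ▸ single_le_sum (f := fun a => π a a') (fun _ _ => h.nonneg _ _) (mem_univ a)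

theorem sum_eq (h : Couples r s π) : ∑ a, ∑ a', π a a' = ∑ a, r a :=
  sum_congr rfl fun a _ => h.fst a

theorem diag [DecidableEq α] (hr : ∀ a, 0 ≤ r a) :
    Couples r r fun a a' => if a = a' then r a else 0 where
  nonneg a a' := by split_ifs <;> simp [hr]
  fst a := by simp
  snd a' := by simp

/-- Gluing: two couplings with a common marginal are composed by making the outer variables
conditionally independent given the middle one. Where `s b = 0` the quotient is the junk value `0`,
which is right because both factors vanish there. -/
theorem comp {π' : α → α → ℝ} (h : Couples r s π) (h' : Couples s t π') :
    Couples r t fun a c => ∑ b, π a b * π' b c / s b where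
  nonneg a c := sum_nonneg fun b _ =>
    div_nonneg (mul_nonneg (h.nonneg _ _) (h'.nonneg _ _)) (h.right_nonneg b)
  fst a := by
    rw [sum_comm, ← h.fst a]
    refine sum_congr rfl fun b _ => ?_
    rw [← sum_div, ← mul_sum, h'.fst]
    refine mul_div_cancel_of_imp fun hb => le_antisymm (hb ▸ h.le_right a b) (h.nonneg a b)
  snd c := by
    rw [sum_comm, ← h'.snd c]
    refine sum_congr rfl fun b _ => ?_
    rw [← sum_div, ← sum_mul, h.snd]
    refine mul_div_cancel_left_of_imp fun hb => le_antisymm (hb ▸ h'.le_left b c) (h'.nonneg b c)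

/-- Mixtures of couplings are couplings of the mixtures. -/
theorem mix {κ : Type*} [Fintype κ] {c : κ → ℝ} (hc : ∀ k, 0 ≤ c k) {r s : κ → α → ℝ}
    {π : κ → α → α → ℝ} (h : ∀ k, Couples (r k) (s k) (π k)) :
    Couples (fun a => ∑ k, c k * r k a) (fun a => ∑ k, c k * s k a)
      fun a a' => ∑ k, c k * π k a a' where
  nonneg a a' := sum_nonneg fun k _ => mul_nonneg (hc k) ((h k).nonneg a a')
  fst a := by
    rw [sum_comm]
    exact sum_congr rfl fun k _ => by rw [← mul_sum, (h k).fst]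
  snd a' := by
    rw [sum_comm]
    exact sum_congr rfl fun k _ => by rw [← mul_sum, (h k).snd]

/-- The image of a coupling under a pair of maps. -/
theorem map [DecidableEq β] (f g : α → β) (h : Couples r s π) :
    Couples (push f r) (push g s) (push₂ f g π) where
  nonneg b b' := push_nonneg f (fun a => push_nonneg g (h.nonneg a) b') b
  fst b := by simp only [push₂, sum_push_comm, sum_push, h.fst]
  snd b' := by simp only [push₂, sum_push, sum_push_comm, h.snd]

/-- One step of the construction of a coupling that is maximal along a filtration. A coupling of the
images under `f` which is maximal on the diagonal lifts to a coupling of `r` and `s` which is maximal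
on the diagonal. The diagonal of the lift carries `min r s`; what remains of `r` and of `s` in each
fibre is spread, in product form, over what remains of the given coupling. -/
theorem lift [DecidableEq α] [DecidableEq β] {f : α → β} {ϖ : β → β → ℝ}
    (hr : ∀ a, 0 ≤ r a) (hs : ∀ a, 0 ≤ s a) (h : Couples (push f r) (push f s) ϖ)
    (hd : ∀ b, min (push f r b) (push f s b) ≤ ϖ b b) :
    ∃ π, Couples r s π ∧ (∀ a, min (r a) (s a) ≤ π a a) ∧
      push₂ f f π = ϖ := by
  set μ : α → ℝ := fun a => min (r a) (s a) with hμ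
  set m : β → ℝ := push f μ with hm
  set R : β → ℝ := push f (fun a => r a - μ a) with hR
  set S : β → ℝ := push f (fun a => s a - μ a) with hS
  set c : β → β → ℝ := fun b b' => ϖ b b' - if b = b' then m b else 0 with hc
  have hRe : ∀ b, R b = push f r b - m b := push_sub f r μ
  have hSe : ∀ b, S b = push f s b - m b := push_sub f s μ
  have hr' : ∀ a, 0 ≤ r a - μ a := fun a => sub_nonneg.2 (min_le_left _ _)
  have hs' : ∀ a, 0 ≤ s a - μ a := fun a => sub_nonneg.2 (min_le_right _ _)
  have hR0 : ∀ b, 0 ≤ R b := push_nonneg f hr'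
  have hS0 : ∀ b, 0 ≤ S b := push_nonneg f hs'
  have hc0 : ∀ b b', 0 ≤ c b b' := by
    intro b b'
    by_cases hb : b = b'
    · subst hb
      simp only [hc, if_true, sub_nonneg]
      exact (le_min (push_mono f (fun a => min_le_left _ _) b)
        (push_mono f (fun a => min_le_right _ _) b)).trans (hd b)
    · simp [hc, hb, h.nonneg]
  have hcR : ∀ b, ∑ b', c b b' = R b := fun b => by simp [hc, sum_sub_distrib, h.fst, hRe]
  have hcS : ∀ b', ∑ b, c b b' = S b' := fun b' => by simp [hc, sum_sub_distrib, h.snd, hSe]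
  have hcR0 : ∀ b b', R b = 0 → c b b' = 0 := fun b b' hb =>
    (sum_eq_zero_iff_of_nonneg fun _ _ => hc0 _ _).1 ((hcR b).trans hb) b' (mem_univ _)
  have hcS0 : ∀ b b', S b' = 0 → c b b' = 0 := fun b b' hb =>
    (sum_eq_zero_iff_of_nonneg fun _ _ => hc0 _ _).1 ((hcS b').trans hb) b (mem_univ _)
  have hra : ∀ a, R (f a) = 0 → r a - μ a = 0 := by
    intro a ha
    have := (sum_eq_zero_iff_of_nonneg fun x _ => by split_ifs <;> simp [hr']).1 ha a (mem_univ a)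
    simpa using this
  have hsa : ∀ a, S (f a) = 0 → s a - μ a = 0 := by
    intro a ha
    have := (sum_eq_zero_iff_of_nonneg fun x _ => by split_ifs <;> simp [hs']).1 ha a (mem_univ a)
    simpa using this
  set ν : α → α → ℝ := fun a a' =>
    c (f a) (f a') * ((r a - μ a) / R (f a)) * ((s a' - μ a') / S (f a')) with hν
  have hν0 : ∀ a a', 0 ≤ ν a a' := fun a a' =>
    mul_nonneg (mul_nonneg (hc0 _ _) (div_nonneg (hr' _) (hR0 _))) (div_nonneg (hs' _) (hS0 _))
  -- spreading the mass `C` over a fibre in proportion to `v` keeps its total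
  have fib : ∀ (v : α → ℝ) (V : β → ℝ) (b : β), push f v b = V b → ∀ C : ℝ, (V b = 0 → C = 0) →
      push f (fun a => C * (v a / V (f a))) b = C := by
    intro v V b hV C hC
    have : push f (fun a => C * (v a / V (f a))) b = C * (push f v b / V b) := by
      simp only [push, sum_div, mul_sum]
      refine sum_congr rfl fun a _ => ?_
      split_ifs with hb
      · rw [hb]
      · simp
    rw [this, hV]
    by_cases h0 : V b = 0
    · simp [hC h0]
    · rw [div_self h0, mul_one]
  have hfst : ∀ a b', push f (fun a' => ν a a') b' = c (f a) b' * ((r a - μ a) / R (f a)) := by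
    intro a b'
    rw [← fib (fun a => s a - μ a) S b' rfl (c (f a) b' * ((r a - μ a) / R (f a)))
      (fun h0 => by rw [hcS0 _ _ h0, zero_mul])]
    exact sum_congr rfl fun a' _ => by split_ifs with hb <;> simp [hν, hb]
  refine ⟨fun a a' => (if a = a' then μ a else 0) + ν a a', ⟨?_, ?_, ?_⟩, ?_, ?_⟩
  · intro a a'
    refine add_nonneg ?_ (hν0 _ _)
    split_ifs
    exacts [le_min (hr _) (hs _), le_rfl]
  · intro a
    rw [sum_add_distrib, ← sum_push f (fun a' => ν a a')]
    simp only [hfst, ← sum_mul, hcR]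
    rw [mul_div_cancel_of_imp' (hra a)]
    simp
  · intro a'
    have : ∀ b, push f (fun a => ν a a') b = c b (f a') * ((s a' - μ a') / S (f a')) := by
      intro b
      rw [← fib (fun a => r a - μ a) R b rfl (c b (f a') * ((s a' - μ a') / S (f a')))
        (fun h0 => by rw [hcR0 _ _ h0, zero_mul])]
      exact sum_congr rfl fun a _ => by
        split_ifs with hb
        · simp only [hν, hb]; ring
        · rfl
    rw [sum_add_distrib, ← sum_push f (fun a => ν a a')]
    simp only [this, ← sum_mul, hcS]
    rw [mul_div_cancel_of_imp' (hsa a')]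
    simp
  · intro a
    simpa only [if_true] using le_add_of_nonneg_right (hν0 a a)
  · funext b b'
    have h1 : ∀ a, push f (fun a' => (if a = a' then μ a else 0) + ν a a') b' =
        (if f a = b' then μ a else 0) + c (f a) b' * ((r a - μ a) / R (f a)) := by
      intro a
      rw [push_add, hfst, push, sum_eq_single a] <;> simp +contextual [eq_comm]
    have h2 : push f (fun a => c (f a) b' * ((r a - μ a) / R (f a))) b = c b b' := by
      rw [← fib (fun a => r a - μ a) R b rfl (c b b') (hcR0 b b')]
      exact sum_congr rfl fun a _ => by split_ifs with hb <;> simp [hb]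
    rw [push₂, funext h1, push_add, h2, push_ite, hc, add_sub_cancel]

theorem min_le_push₂ [DecidableEq α] {G : α → α} (hG : ∀ a, G (G a) = G a)
    (h : Couples (push G r) (push G s) π) (hd : ∀ b, min (push G r b) (push G s b) ≤ π b b) (b : α) :
    min (push G r b) (push G s b) ≤ push₂ G G π b b := by
  have h0 : ∀ a, 0 ≤ push G (π a) b := fun a => push_nonneg G (h.nonneg a) b
  by_cases hb : G b = b
  · refine (hd b).trans ?_
    calc π b b ≤ push G (π b) b := by
          have := single_le_sum (f := fun a' => if G a' = b then π b a' else 0)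
            (fun a' _ => by split_ifs <;> simp [h.nonneg]) (mem_univ b)
          simpa [hb, push] using this
      _ ≤ push₂ G G π b b := by
          have := single_le_sum (f := fun a => if G a = b then push G (π a) b else 0)
            (fun a _ => by split_ifs <;> simp [h0]) (mem_univ b)
          simpa [hb, push₂, push] using this
  · -- `b` is not in the range of the idempotent `G`
    have : push G r b = 0 := sum_eq_zero fun a _ => if_neg fun ha => hb (by rw [← ha, hG])
    exact (min_le_left _ _).trans (this ▸ push_nonneg G h0 b)

/-- A coupling maximal along an increasing chain of maps `F 0, F 1, …`, each of which factors through
the next ones and the first of which forgets everything. -/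
theorem exists_chain [DecidableEq α] (hr : ∀ a, 0 ≤ r a) (hs : ∀ a, 0 ≤ s a) (F : ℕ → α → α)
    (hF : ∀ j n, j ≤ n → ∀ a, F j (F n a) = F j a) (h0 : push (F 0) r = push (F 0) s) (n : ℕ) :
    ∃ π, Couples (push (F n) r) (push (F n) s) π ∧
      (∀ b, min (push (F n) r b) (push (F n) s b) ≤ π b b) ∧
      ∀ j ≤ n, ∀ b, min (push (F j) r b) (push (F j) s b) ≤ push₂ (F j) (F j) π b b := by
  induction n with
  | zero =>
    have h1 := diag (push_nonneg (F 0) hr)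
    have hd : ∀ b, min (push (F 0) r b) (push (F 0) r b) ≤ if b = b then push (F 0) r b else 0 :=
      fun b => by simp
    rw [← h0]
    refine ⟨_, h1, hd, fun j hj b => ?_⟩
    obtain rfl : j = 0 := by omega
    rw [← h0]
    exact min_le_push₂ (hF 0 0 le_rfl) h1 hd b
  | succ n ih =>
    obtain ⟨ϖ, hϖ, hd, hj⟩ := ih
    have hp : ∀ v : α → ℝ, push (F n) (push (F (n + 1)) v) = push (F n) v := fun v => by
      rw [push_push]
      simp only [hF n (n + 1) n.le_succ]
    obtain ⟨π, hπ, hmin, hpush⟩ := lift (f := F n) (push_nonneg (F (n + 1)) hr)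
      (push_nonneg (F (n + 1)) hs) (by rwa [hp, hp]) (by rwa [hp, hp])
    refine ⟨π, hπ, hmin, fun j hjn b => ?_⟩
    rcases hjn.lt_or_eq with hjn | rfl
    · have hjn : j ≤ n := by omega
      have := hj j hjn b
      rw [← hpush, push₂_push₂] at this
      simpa only [hF j n hjn] using this
    · exact min_le_push₂ (hF _ _ le_rfl) hπ hmin b

end Couples

/-! ### Site by site disagreement probabilities -/

section Disagreement

variable {ι X : Type*} [Fintype ι] [DecidableEq ι] [Fintype X] [DecidableEq X]
  {r s t : (ι → X) → ℝ} {b b' : ι → ℝ}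

/-- The weight which `π` gives to the pairs that disagree at the site `i`. -/
def disag (π : (ι → X) → (ι → X) → ℝ) (i : ι) : ℝ := ∑ a, ∑ a', if a i = a' i then 0 else π a a'

/-- The weights `r` and `s` have a coupling whose disagreement at every site `i` is at most `b i`. -/
def Coupled (r s : (ι → X) → ℝ) (b : ι → ℝ) : Prop := ∃ π, Couples r s π ∧ ∀ i, disag π i ≤ b i

theorem Couples.disag_nonneg {π : (ι → X) → (ι → X) → ℝ} (h : Couples r s π) (i : ι) :
    0 ≤ disag π i :=
  sum_nonneg fun a _ => sum_nonneg fun a' _ => by split_ifs <;> simp [h.nonneg]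

theorem Coupled.mono (h : Coupled r s b) (hb : ∀ i, b i ≤ b' i) : Coupled r s b' := by
  obtain ⟨π, hπ, hd⟩ := h
  exact ⟨π, hπ, fun i => (hd i).trans (hb i)⟩

theorem Coupled.refl (hr : ∀ a, 0 ≤ r a) : Coupled r r fun _ => 0 := by
  refine ⟨_, Couples.diag hr, fun i => le_of_eq ?_⟩
  refine sum_eq_zero fun a _ => sum_eq_zero fun a' _ => ?_
  by_cases h : a = a' <;> simp [h]

theorem Coupled.trans (h : Coupled r s b) (h' : Coupled s t b') :
    Coupled r t fun i => b i + b' i := by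
  obtain ⟨π, hπ, hd⟩ := h
  obtain ⟨π', hπ', hd'⟩ := h'
  refine ⟨_, hπ.comp hπ', fun i => le_trans ?_ (add_le_add (hd i) (hd' i))⟩
  have hw : ∀ a c e, 0 ≤ π a c * π' c e / s c := fun a c e =>
    div_nonneg (mul_nonneg (hπ.nonneg _ _) (hπ'.nonneg _ _)) (hπ.right_nonneg c)
  have h1 : ∀ a c, ∑ e, π a c * π' c e / s c = π a c := fun a c => by
    rw [← sum_div, ← mul_sum, hπ'.fst]
    exact mul_div_cancel_of_imp fun hb => le_antisymm (hb ▸ hπ.le_right a c) (hπ.nonneg a c)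
  have h2 : ∀ c e, ∑ a, π a c * π' c e / s c = π' c e := fun c e => by
    rw [← sum_div, ← sum_mul, hπ.snd]
    exact mul_div_cancel_left_of_imp fun hb => le_antisymm (hb ▸ hπ'.le_left c e) (hπ'.nonneg c e)
  calc disag (fun a e => ∑ c, π a c * π' c e / s c) i
      ≤ ∑ a, ∑ e, ∑ c, ((if a i = c i then 0 else π a c * π' c e / s c) +
          if c i = e i then 0 else π a c * π' c e / s c) := by
        refine sum_le_sum fun a _ => sum_le_sum fun e _ => ?_
        split_ifs with hae
        · exact sum_nonneg fun c _ => by split_ifs <;> simp [hw]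
        · refine sum_le_sum fun c _ => ?_
          have := hw a c e
          split_ifs with h3 h4
          · exact absurd (h3.trans h4) hae
          all_goals linarith
    _ = disag π i + disag π' i := by
        simp only [sum_add_distrib]
        congr 1
        · refine sum_congr rfl fun a _ => ?_
          rw [sum_comm]
          refine sum_congr rfl fun c _ => ?_
          split_ifs <;> simp [h1]
        · rw [sum_comm, disag, sum_comm (f := fun a a' => if a i = a' i then 0 else π' a a')]
          refine sum_congr rfl fun e _ => ?_
          rw [sum_comm]
          refine sum_congr rfl fun c _ => ?_
          split_ifs <;> simp [h2]

theorem Coupled.mix {κ : Type*} [Fintype κ] {c : κ → ℝ} (hc : ∀ k, 0 ≤ c k)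
    {r s : κ → (ι → X) → ℝ} {b : κ → ι → ℝ} (h : ∀ k, Coupled (r k) (s k) (b k)) :
    Coupled (fun a => ∑ k, c k * r k a) (fun a => ∑ k, c k * s k a) fun i => ∑ k, c k * b k i := by
  choose π hπ hd using h
  refine ⟨_, Couples.mix hc hπ, fun i => le_trans (le_of_eq ?_)
    (sum_le_sum fun k _ => mul_le_mul_of_nonneg_left (hd k i) (hc k))⟩
  simp only [disag, mul_sum]
  rw [sum_comm (s := univ (α := κ))]
  refine sum_congr rfl fun a _ => ?_
  rw [sum_comm (s := univ (α := κ))]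
  exact sum_congr rfl fun a' _ => by split_ifs <;> simp

/-- A maximal coupling along the filtration given by a height function on the sites. If, for each
site `i`, the weights `r` and `s` of the events which depend only on the sites not lower than `i`
differ by at most `b i`, then one coupling of `r` and `s` achieves all these bounds at once. -/
theorem coupled_of_height (hr : ∀ a, 0 ≤ r a) (hs : ∀ a, 0 ≤ s a) (hrs : ∑ a, r a = ∑ a, s a)
    (h : ι → ℕ) (hb : ∀ i, ∀ B : Set (ι → X),
      (∀ a a', (∀ j, h i ≤ h j → a j = a' j) → a ∈ B → a' ∈ B) →
      ∀ [DecidablePred (· ∈ B)], ∑ a with a ∈ B, (r a - s a) ≤ b i) :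
    Coupled r s b := by
  cases isEmpty_or_nonempty (ι → X) with
  | inl h0 => exact ⟨fun _ _ => 0, ⟨fun a => h0.elim a, fun a => h0.elim a, fun a => h0.elim a⟩,
      fun i => by simpa [disag] using hb i ∅ (by simp)⟩
  | inr h0 =>
  obtain ⟨x⟩ := h0
  set K := univ.sup h + 1 with hK
  have hhK : ∀ i, h i < K := fun i => Nat.lt_succ_of_le (le_sup (mem_univ i))
  -- `F n` keeps the sites of height at least `K - n` and resets the others
  set F : ℕ → (ι → X) → ι → X := fun n a i => if K ≤ h i + n then a i else x i with hF
  have hFF : ∀ j n, j ≤ n → ∀ a, F j (F n a) = F j a := by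
    intro j n hjn a
    funext i
    simp only [hF]
    split_ifs <;> first | rfl | omega
  have hF0 : ∀ a, F 0 a = x := fun a => funext fun i => if_neg (by have := hhK i; omega)
  have hFK : ∀ a, F K a = a := fun a => funext fun i => if_pos (by omega)
  have hpK : ∀ v : (ι → X) → ℝ, push (F K) v = v := fun v => by
    funext a
    simp [push, hFK]
  obtain ⟨π, hπ, -, hj⟩ := Couples.exists_chain hr hs F hFF (by
    funext a
    simp only [push, hF0]
    split_ifs <;> simp [hrs]) K
  rw [hpK, hpK] at hπ
  refine ⟨π, hπ, fun i => ?_⟩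
  -- `G` keeps exactly the sites not lower than `i`, so a disagreement at `i` is one of `G a`, `G a'`
  set G := F (K - h i) with hG
  have hGi : ∀ a, G a i = a i := fun a => if_pos (by have := hhK i; omega)
  have hdiag : ∑ a, ∑ a', (if G a = G a' then π a a' else 0) = ∑ b, push₂ G G π b b := by
    simp only [push₂]
    symm
    simp only [push]
    rw [sum_comm]
    refine sum_congr rfl fun a _ => ?_
    rw [sum_ite_eq, if_pos (mem_univ _)]
    exact sum_congr rfl fun a' _ => by simp only [eq_comm]
  have hB := hb i {a | push G s (G a) < push G r (G a)} (by
    intro a a' haa ha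
    have : G a = G a' := by
      funext j
      simp only [hG, hF]
      split_ifs with hj
      · exact haa j (by have := hhK i; omega)
      · rfl
    rwa [Set.mem_ofPred_eq, ← this])
  refine le_trans ?_ hB
  calc disag π i ≤ ∑ a, ∑ a', (π a a' - if G a = G a' then π a a' else 0) := by
        refine sum_le_sum fun a _ => sum_le_sum fun a' _ => ?_
        by_cases h1 : G a = G a'
        · have : a i = a' i := by rw [← hGi a, ← hGi a', h1]
          simp [this, h1]
        · simp only [h1, if_false, sub_zero]
          split_ifs <;> simp [hπ.nonneg]
    _ = ∑ b, (push G r b - push₂ G G π b b) := by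
        simp only [sum_sub_distrib]
        rw [hdiag, hπ.sum_eq, sum_push]
    _ ≤ ∑ b, (push G r b - min (push G r b) (push G s b)) :=
        sum_le_sum fun b _ => sub_le_sub_left (hj _ (by omega) b) _
    _ = ∑ b, (if push G s b < push G r b then 1 else 0) * push G (fun a => r a - s a) b := by
        refine sum_congr rfl fun b _ => ?_
        rw [push_sub]
        split_ifs with h1
        · rw [min_eq_right h1.le, one_mul]
        · rw [min_eq_left (not_lt.1 h1), sub_self, zero_mul]
    _ = _ := by
        rw [sum_mul_push, sum_filter]
        simp

end Disagreement

/-! ### Probability measures as weights -/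

section Mass

variable {α β : Type*}

/-- The weight of a probability measure: real-valued point masses. -/
def mass (r : PMF α) (a : α) : ℝ := (r a).toReal

theorem mass_nonneg (r : PMF α) (a : α) : 0 ≤ mass r a := ENNReal.toReal_nonneg

theorem mass_injective : Function.Injective (mass : PMF α → α → ℝ) := fun r s h =>
  PMF.ext fun a => (ENNReal.toReal_eq_toReal_iff' (r.apply_ne_top a) (s.apply_ne_top a)).1
    (congr_fun h a)

theorem bddAbove_tv (r s : PMF α) :
    BddAbove (Set.range fun A : Set α => |prob r A - prob s A|) := by
  have h : ∀ (r : PMF α) A, 0 ≤ prob r A ∧ prob r A ≤ 1 := fun r A =>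
    ⟨ENNReal.toReal_nonneg, ENNReal.toReal_le_of_le_ofReal zero_le_one
      (by
        rw [ENNReal.ofReal_one, ← r.tsum_coe, PMF.toOuterMeasure_apply]
        exact ENNReal.tsum_le_tsum fun a => Set.indicator_le_self _ _ a)⟩
  refine ⟨1, ?_⟩
  rintro _ ⟨A, rfl⟩
  have h1 := h r A
  have h2 := h s A
  exact abs_le.2 ⟨by linarith, by linarith⟩

theorem prob_sub_le_tv (r s : PMF α) (A : Set α) : prob r A - prob s A ≤ tv r s :=
  (le_abs_self _).trans (le_ciSup (bddAbove_tv r s) A)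

theorem prob_map (f : α → β) (r : PMF α) (A : Set β) : prob (r.map f) A = prob r (f ⁻¹' A) := by
  rw [prob, PMF.toOuterMeasure_map_apply, prob]

variable [Fintype α]

theorem sum_mass (r : PMF α) : ∑ a, mass r a = 1 := by
  have h := r.tsum_coe
  rw [tsum_fintype] at h
  rw [← ENNReal.toReal_one, ← h, ENNReal.toReal_sum fun a _ => r.apply_ne_top a]
  rfl

theorem prob_eq_sum (r : PMF α) (A : Set α) [DecidablePred (· ∈ A)] :
    prob r A = ∑ a, if a ∈ A then mass r a else 0 := by
  rw [prob, PMF.toOuterMeasure_apply_fintype, ENNReal.toReal_sum]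
  · refine sum_congr rfl fun a _ => ?_
    by_cases h : a ∈ A <;> simp [h, mass]
  · intro a _
    by_cases h : a ∈ A <;> simp [h, r.apply_ne_top]

theorem mass_map [DecidableEq β] (f : α → β) (r : PMF α) : mass (r.map f) = push f (mass r) := by
  funext b
  rw [mass, PMF.map_apply, tsum_fintype, ENNReal.toReal_sum, push]
  · exact sum_congr rfl fun a _ => by simp only [eq_comm (a := b)]; split_ifs <;> simp [mass]
  · intro a _
    split_ifs <;> simp [r.apply_ne_top]

theorem exists_mass_eq {w : α → ℝ} (h0 : ∀ a, 0 ≤ w a) (h1 : ∑ a, w a = 1) :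
    ∃ r : PMF α, mass r = w := by
  refine ⟨PMF.ofFintype (fun a => ENNReal.ofReal (w a)) ?_, ?_⟩
  · rw [← ENNReal.ofReal_sum_of_nonneg fun a _ => h0 a, h1, ENNReal.ofReal_one]
  · funext a
    simp [mass, h0]

theorem expect_eq (r : PMF α) (f : α → ℝ) : expect r f = ∑ a, mass r a * f a := rfl

theorem isCoupling_iff [DecidableEq α] {r s : PMF α} {π : PMF (α × α)} :
    IsCoupling π r s ↔ Couples (mass r) (mass s) fun a a' => mass π (a, a') := by
  have h1 : ∀ a, push Prod.fst (mass π) a = ∑ a', mass π (a, a') := fun a => by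
    rw [push, Fintype.sum_prod_type, sum_comm]
    simp
  have h2 : ∀ a', push Prod.snd (mass π) a' = ∑ a, mass π (a, a') := fun a' => by
    simp [push, Fintype.sum_prod_type]
  rw [IsCoupling, ← mass_injective.eq_iff, ← mass_injective.eq_iff (b := s), mass_map, mass_map]
  refine ⟨fun h => ⟨fun a a' => mass_nonneg π _, fun a => ?_, fun a' => ?_⟩,
    fun h => ⟨funext fun a => ?_, funext fun a' => ?_⟩⟩
  · rw [← h1, h.1]
  · rw [← h2, h.2]
  · rw [h1, h.fst]
  · rw [h2, h.snd]

end Mass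

/-! ### The transport distance -/

section W2

variable {ι X : Type*} [Fintype ι] [DecidableEq ι] [Fintype X] [DecidableEq X]

theorem prob_ne_eq_disag (π : PMF ((ι → X) × (ι → X))) (i : ι) :
    prob π {z | z.1 i ≠ z.2 i} = disag (fun a a' => mass π (a, a')) i := by
  rw [prob_eq_sum, Fintype.sum_prod_type]
  simp [disag]

theorem W2_eq (r s : PMF (ι → X)) :
    W2 r s = sInf ((fun π => √(∑ i, disag π i ^ 2)) '' {π | Couples (mass r) (mass s) π}) := by
  refine congrArg sInf (Set.ext fun c => ?_)
  constructor
  · rintro ⟨π, hπ, rfl⟩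
    exact ⟨_, isCoupling_iff.1 hπ, by simp [prob_ne_eq_disag]⟩
  · rintro ⟨w, hw, rfl⟩
    obtain ⟨π, hπ⟩ := exists_mass_eq (w := fun x : (ι → X) × (ι → X) => w x.1 x.2)
      (fun x => hw.nonneg _ _) (by rw [Fintype.sum_prod_type, hw.sum_eq, sum_mass])
    have hw' : w = fun a a' => mass π (a, a') := by simp [hπ]
    rw [Set.mem_ofPred_eq, hw'] at hw
    refine ⟨π, isCoupling_iff.2 hw, ?_⟩
    simp only [prob_ne_eq_disag, hw']

theorem W2_nonneg (r s : PMF (ι → X)) : 0 ≤ W2 r s := by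
  rw [W2_eq]
  refine Real.sInf_nonneg ?_
  rintro _ ⟨π, -, rfl⟩
  exact Real.sqrt_nonneg _

theorem W2_sq_le {r s : PMF (ι → X)} {b : ι → ℝ} (h : Coupled (mass r) (mass s) b) :
    W2 r s ^ 2 ≤ ∑ i, b i ^ 2 := by
  obtain ⟨π, hπ, hd⟩ := h
  have h1 : W2 r s ≤ √(∑ i, disag π i ^ 2) := by
    rw [W2_eq]
    refine csInf_le ⟨0, ?_⟩ ⟨π, hπ, rfl⟩
    rintro _ ⟨π, -, rfl⟩
    exact Real.sqrt_nonneg _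
  calc W2 r s ^ 2 ≤ √(∑ i, disag π i ^ 2) ^ 2 := pow_le_pow_left₀ (W2_nonneg r s) h1 2
    _ = ∑ i, disag π i ^ 2 := Real.sq_sqrt (sum_nonneg fun i _ => sq_nonneg _)
    _ ≤ ∑ i, b i ^ 2 := sum_le_sum fun i _ => pow_le_pow_left₀ (hπ.disag_nonneg i) (hd i) 2

/-- The infimum in the definition of `W₂` is attained: the couplings form a compact set. -/
theorem exists_optimal (r s : PMF (ι → X)) :
    ∃ π, Couples (mass r) (mass s) π ∧ ∑ i, disag π i ^ 2 = W2 r s ^ 2 := by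
  set K := {π : (ι → X) → (ι → X) → ℝ | Couples (mass r) (mass s) π} with hK
  have hKeq : K = {π | (∀ a a', 0 ≤ π a a') ∧ (∀ a, ∑ a', π a a' = mass r a) ∧
      ∀ a', ∑ a, π a a' = mass s a'} := by
    ext π
    exact ⟨fun h => ⟨h.nonneg, h.fst, h.snd⟩, fun h => ⟨h.1, h.2.1, h.2.2⟩⟩
  have hev : ∀ a a', Continuous fun π : (ι → X) → (ι → X) → ℝ => π a a' := fun a a' =>
    (continuous_apply a').comp (continuous_apply a)
  have hcl : IsClosed K := by
    rw [hKeq]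
    simp only [Set.ofPred_and, Set.ofPred_forall]
    refine IsClosed.inter ?_ (IsClosed.inter ?_ ?_)
    · exact isClosed_iInter fun a => isClosed_iInter fun a' => isClosed_le continuous_const (hev a a')
    · exact isClosed_iInter fun a => isClosed_eq (continuous_finsetSum _ fun a' _ => hev a a')
        continuous_const
    · exact isClosed_iInter fun a' => isClosed_eq (continuous_finsetSum _ fun a _ => hev a a')
        continuous_const
  have hcomp : IsCompact K := by
    refine IsCompact.of_isClosed_subset (isCompact_univ_pi fun a => isCompact_univ_pi fun a' =>
      isCompact_Icc (a := (0 : ℝ)) (b := mass r a)) hcl fun π hπ a _ a' _ => ?_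
    exact ⟨hπ.nonneg _ _, hπ.le_left _ _⟩
  have hne : K.Nonempty := by
    refine ⟨fun a a' => mass r a * mass s a', ⟨fun a a' =>
      mul_nonneg (mass_nonneg _ _) (mass_nonneg _ _), fun a => ?_, fun a' => ?_⟩⟩
    · rw [← mul_sum, sum_mass, mul_one]
    · rw [← sum_mul, sum_mass, one_mul]
  have hcont : Continuous fun π : (ι → X) → (ι → X) → ℝ => √(∑ i, disag π i ^ 2) := by
    refine Real.continuous_sqrt.comp (continuous_finsetSum _ fun i _ => Continuous.pow ?_ 2)
    refine continuous_finsetSum _ fun a _ => continuous_finsetSum _ fun a' _ => ?_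
    split_ifs
    · exact continuous_const
    · exact hev a a'
  obtain ⟨π, hπ, hmin⟩ := hcomp.exists_sInf_image_eq hne hcont.continuousOn
  refine ⟨π, hπ, ?_⟩
  rw [W2_eq, hmin, Real.sq_sqrt (sum_nonneg fun i _ => sq_nonneg _)]

theorem coupled_of_height_pmf (r s : PMF (ι → X)) (h : ι → ℕ) (b : ι → ℝ)
    (hb : ∀ i, ∀ B : Set (ι → X), (∀ a a', (∀ j, h i ≤ h j → a j = a' j) → a ∈ B → a' ∈ B) →
      prob r B - prob s B ≤ b i) :
    Coupled (mass r) (mass s) b := by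
  refine coupled_of_height (mass_nonneg r) (mass_nonneg s) (by rw [sum_mass, sum_mass]) h
    fun i B hB _ => ?_
  have := hb i B hB
  rwa [prob_eq_sum, prob_eq_sum, ← sum_filter, ← sum_filter, ← sum_sub_distrib] at this

theorem W2_sq_le_tv_sq (r s : PMF (ι → X)) : W2 r s ^ 2 ≤ Fintype.card ι * tv r s ^ 2 := by
  have h := coupled_of_height_pmf r s (fun _ => 0) (fun _ => tv r s)
    fun i B _ => prob_sub_le_tv r s B
  simpa using W2_sq_le h

end W2

/-! ### Dependence of the conditional distributions on the outside configuration -/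

section Dependence

variable {d : ℕ} {X : Type u} [Fintype X] [DecidableEq X] {q : Specification d X} {l : ℕ} {φ : ℕ → ℝ}

/-- Strong mixing bounds the effect of one outside site `k` on all events that depend on the sites at
a given distance from `k` or farther. A coupling that is maximal along the filtration by the distance
from `k` turns this into simultaneous bounds at all sites. -/
theorem Specification.StronglyMixingOver.coupled_of_single (hq : q.StronglyMixingOver l φ)
    {J : Finset (Site d)} (hJ : J ∈ cubeUnions d l) {k : Site d} (hk : k ∉ J) {x x' : Site d → X}
    (h : ∀ i, i ∉ J → i ≠ k → x i = x' i) :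
    Coupled (mass (q.law J x)) (mass (q.law J x')) fun j : J => φ (rho k j) := by
  refine coupled_of_height_pmf _ _ (fun j : J => rho k j) _ fun i B hB => ?_
  have hMJ : J.filter (fun j => rho k i ≤ rho k j) ⊆ J := filter_subset _ _
  have hiM : i.1 ∈ J.filter (fun j => rho k i ≤ rho k j) := mem_filter.2 ⟨i.2, le_rfl⟩
  have hmix := hq J hJ _ hMJ ⟨i, hiM⟩ k hk x x' h
  have hr : rhoSet k (J.filter fun j => rho k i ≤ rho k j) ⟨i, hiM⟩ = rho k i :=
    le_antisymm (inf'_le _ hiM) ((le_inf'_iff _ _).2 fun j hj => (mem_filter.1 hj).2)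
  rw [hr] at hmix
  refine le_trans ?_ hmix
  -- the event `B` is the preimage of its image under the restriction map
  have hpre : restrict₂ (π := fun _ => X) hMJ ⁻¹' (restrict₂ (π := fun _ => X) hMJ '' B) = B := by
    refine Set.Subset.antisymm ?_ (Set.subset_preimage_image _ _)
    rintro a ⟨a', ha', haa⟩
    exact hB a' a (fun j hj => congr_fun haa ⟨j, mem_filter.2 ⟨j.2, hj⟩⟩) ha'
  have h1 := prob_sub_le_tv (marginal hMJ (q.law J x)) (marginal hMJ (q.law J x'))
    (restrict₂ (π := fun _ => X) hMJ '' B)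
  rwa [marginal, marginal, prob_map, prob_map, hpre] at h1

theorem Specification.StronglyMixingOver.coupled_of_finset (hq : q.StronglyMixingOver l φ)
    {J : Finset (Site d)} (hJ : J ∈ cubeUnions d l) (K : Finset (Site d)) (hK : ∀ k ∈ K, k ∉ J)
    (x x' : Site d → X) (h : ∀ i, i ∉ J → i ∉ K → x i = x' i) :
    Coupled (mass (q.law J x)) (mass (q.law J x')) fun j : J => ∑ k ∈ K, φ (rho k j) := by
  induction K using Finset.induction_on generalizing x with
  | empty =>
    rw [q.law_congr J x x' fun i hi => h i hi (by simp)]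
    simpa using Coupled.refl (mass_nonneg (q.law J x'))
  | insert k K hkK ih =>
    have h1 := hq.coupled_of_single hJ (hK k (mem_insert_self k K)) (x := x)
      (x' := Function.update x k (x' k)) fun i _ hik => (Function.update_of_ne hik _ _).symm
    have h2 := ih (fun k hk => hK k (mem_insert_of_mem hk)) (Function.update x k (x' k))
      fun i hiJ hiK => by
        by_cases hik : i = k
        · rw [hik, Function.update_self]
        · rw [Function.update_of_ne hik]
          exact h i hiJ (by simp [hik, hiK])
    simpa only [sum_insert hkK] using h1.trans h2

end Dependence

/-! ### Resampling the sites of a subset -/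

section Resampling

variable {d : ℕ} {X : Type u} {J Λ : Finset (Site d)}

/-- The configuration on `Λ` that equals `a` on `J` and `z` elsewhere. -/
def patch (J : Finset (Site d)) (z : Λ → X) (a : J → X) : Λ → X :=
  fun i => if h : i.1 ∈ J then a ⟨i, h⟩ else z i

theorem glue_of_mem (z : Λ → X) (y : Site d → X) (i : Λ) : glue Λ z y i = z i := by
  simp [glue]

variable [Fintype X] [DecidableEq X]

theorem push_patch (hJ : J ⊆ Λ) (z : Λ → X) (v : (J → X) → ℝ) (w : Λ → X) :
    push (patch J z) v w =
      if ∀ i : Λ, i.1 ∉ J → z i = w i then v (restrict₂ (π := fun _ => X) hJ w) else 0 := by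
  have h1 : ∀ a, patch J z a = w ↔
      (∀ i : Λ, i.1 ∉ J → z i = w i) ∧ a = restrict₂ (π := fun _ => X) hJ w := by
    intro a
    constructor
    · rintro rfl
      exact ⟨fun i hi => by simp [patch, hi], funext fun j => by simp [patch]⟩
    · rintro ⟨h2, rfl⟩
      funext i
      by_cases hi : i.1 ∈ J
      · simp [patch, hi, restrict₂]
      · simp [patch, hi, h2 i hi]
  simp only [push, h1]
  split_ifs with h2
  · simp only [eq_true h2, true_and, sum_ite_eq', mem_univ, if_true]
  · simp only [eq_false h2, false_and, if_false, sum_const_zero]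

theorem Coupled.patch {r s : (J → X) → ℝ} {b : J → ℝ} (h : Coupled r s b) (hr : ∑ a, r a = 1)
    (z u : Λ → X) :
    Coupled (push (patch J z) r) (push (patch J u) s) fun i =>
      if hi : i.1 ∈ J then b ⟨i, hi⟩ else if z i = u i then 0 else 1 := by
  obtain ⟨π, hπ, hd⟩ := h
  refine ⟨_, hπ.map _ _, fun i => ?_⟩
  have h1 : disag (push₂ (Lattice.patch J z) (Lattice.patch J u) π) i =
      ∑ a, ∑ a', if Lattice.patch J z a i = Lattice.patch J u a' i then 0 else π a a' := by
    have := sum_push₂_mul (Lattice.patch J z) (Lattice.patch J u) π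
      fun b b' => if b i = b' i then 0 else 1
    simpa only [disag, ite_mul, zero_mul, one_mul] using this
  rw [h1]
  by_cases hi : i.1 ∈ J
  · simpa [Lattice.patch, hi, disag] using hd ⟨i, hi⟩
  · simp only [Lattice.patch, hi, dif_neg, not_false_eq_true]
    split_ifs
    · simp
    · rw [hπ.sum_eq, hr]

/-- Resampling `Y_J` from its conditional law preserves the law of `Y`. -/
theorem mass_eq_sum_condLaw (hJ : J ⊆ Λ) (p : PMF (Λ → X)) (w : Λ → X) :
    mass p w = ∑ z, mass p z * push (patch J z) (mass (condLaw hJ p z)) w := by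
  set P : ℝ := ∑ z, if ∀ i : Λ, i.1 ∉ J → z i = w i then mass p z else 0 with hP
  have h1 : ∀ z, mass p z * push (patch J z) (mass (condLaw hJ p z)) w =
      (if ∀ i : Λ, i.1 ∉ J → z i = w i then mass p z else 0) * (mass p w / P) := by
    intro z
    rw [push_patch hJ]
    by_cases hz : mass p z = 0
    · simp [hz]
    split_ifs with hzw
    · congr 1
      have hex : ∃ w ∈ {w : Λ → X | ∀ i : Λ, i.1 ∉ J → w i = z i}, w ∈ p.support :=
        ⟨z, fun _ _ => rfl, fun h0 => hz (by simp [mass, h0])⟩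
      rw [condLaw, dif_pos hex, marginal, mass_map, push, sum_eq_single w]
      · rw [if_pos rfl, mass, PMF.filter_apply, ENNReal.toReal_mul, ENNReal.toReal_inv,
          Set.indicator_of_mem (by exact fun i hi => (hzw i hi).symm), div_eq_mul_inv, mass,
          tsum_fintype, ENNReal.toReal_sum]
        · congr 2
          refine sum_congr rfl fun z' _ => ?_
          have : (∀ i : Λ, i.1 ∉ J → z' i = w i) ↔
              z' ∈ {w : Λ → X | ∀ i : Λ, i.1 ∉ J → w i = z i} :=
            forall₂_congr fun i hi => by rw [hzw i hi]
          simp only [this, Set.indicator_apply]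
          split_ifs <;> simp [mass]
        · intro z' _
          rw [Set.indicator_apply]
          split_ifs <;> simp [p.apply_ne_top]
      · intro w' _ hw'
        split_ifs with hr
        · rw [mass, PMF.filter_apply_eq_zero_of_notMem, ENNReal.toReal_zero]
          intro hmem
          refine hw' (funext fun i => ?_)
          by_cases hi : i.1 ∈ J
          · exact congr_fun hr ⟨i, hi⟩
          · exact (hmem i hi).trans (hzw i hi)
        · rfl
      · simp
    · simp
  rw [sum_congr rfl fun z _ => h1 z, ← sum_mul]
  refine (mul_div_cancel_of_imp' fun h0 => ?_).symm
  have := (sum_eq_zero_iff_of_nonneg fun z _ => by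
    split_ifs
    exacts [mass_nonneg p z, le_rfl]).1 h0 w (mem_univ w)
  simpa using this

/-- Resampling the sites of `J` by the ensemble preserves `q_Λ(· | ȳ_Λ)`. -/
theorem Specification.mass_eq_sum_law (q : Specification d X) (hJ : J ⊆ Λ) (y : Site d → X)
    (w : Λ → X) :
    mass (q.law Λ y) w =
      ∑ u, mass (q.law Λ y) u * push (patch J u) (mass (q.law J (glue Λ u y))) w := by
  have hc := congr_arg ENNReal.toReal (q.compat J Λ hJ (glue Λ w y))
  rw [ENNReal.toReal_mul, q.law_congr Λ (glue Λ w y) y fun i hi => by simp [glue, hi]] at hc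
  have hw : Λ.restrict (glue Λ w y) = w := funext fun i => glue_of_mem w y i
  rw [hw] at hc
  have hm : (marginal (sdiff_subset : Λ \ J ⊆ Λ) (q.law Λ y)
      ((Λ \ J).restrict (glue Λ w y))).toReal =
      ∑ u, if ∀ i : Λ, i.1 ∉ J → u i = w i then mass (q.law Λ y) u else 0 := by
    change mass _ _ = _
    rw [marginal, mass_map, push]
    refine sum_congr rfl fun u _ => ?_
    have : restrict₂ (π := fun _ => X) (sdiff_subset : Λ \ J ⊆ Λ) u =
        (Λ \ J).restrict (glue Λ w y) ↔ ∀ i : Λ, i.1 ∉ J → u i = w i := by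
      constructor
      · intro h i hi
        have := congr_fun h ⟨i, mem_sdiff.2 ⟨i.2, hi⟩⟩
        simpa [restrict₂, glue] using this
      · intro h
        funext i
        have hi := mem_sdiff.1 i.2
        simpa [restrict₂, glue, hi.1] using h ⟨i, hi.1⟩ hi.2
    simp only [this]
  rw [hm, sum_mul] at hc
  refine hc.trans (sum_congr rfl fun u _ => ?_)
  rw [push_patch hJ]
  split_ifs with h
  · rw [q.law_congr J (glue Λ u y) (glue Λ w y)]
    · congr 2
      congr 1
      funext j
      simp [restrict₂, glue, hJ j.2]
    · intro i hi
      by_cases hiΛ : i ∈ Λ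
      · simpa [glue, hiΛ] using h ⟨i, hiΛ⟩ hi
      · simp [glue, hiΛ]
  · simp

/-- One resampling step. From a coupling `π` of `p` and `q_Λ(· | ȳ_Λ)`, resampling the sites of `J`
produces another one, whose disagreement at `j ∈ J` is bounded by the error `E j` of replacing the
conditional law of `p` by that of the ensemble, plus the influence on `j` of the disagreements
outside `J`. -/
theorem Specification.StronglyMixingOver.exists_resample {q : Specification d X} {l : ℕ} {φ : ℕ → ℝ}
    (hq : q.StronglyMixingOver l φ) (hJΛ : J ⊆ Λ) (hJ : J ∈ cubeUnions d l) (y : Site d → X)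
    (p : PMF (Λ → X)) {π : (Λ → X) → (Λ → X) → ℝ} (hπ : Couples (mass p) (mass (q.law Λ y)) π) :
    ∃ E : Λ → ℝ, (∀ i, i.1 ∉ J → E i = 0) ∧
      ∑ i, E i ^ 2 ≤ expect p (fun z => W2 (condLaw hJΛ p z) (q.law J (glue Λ z y)) ^ 2) ∧
      Coupled (mass p) (mass (q.law Λ y)) fun i : Λ => if i.1 ∈ J then
        E i + ∑ k : Λ, (if k.1 ∈ J then 0 else φ (rho k.1 i.1) * disag π k) else disag π i := by
  choose ϖ hϖ hϖW using fun z => exists_optimal (condLaw hJΛ p z) (q.law J (glue Λ z y))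
  set e : (Λ → X) → Λ → ℝ := fun z i => if hi : i.1 ∈ J then disag (ϖ z) ⟨i, hi⟩ else 0 with he
  have hez : ∀ z, ∑ i, e z i ^ 2 = W2 (condLaw hJΛ p z) (q.law J (glue Λ z y)) ^ 2 := by
    intro z
    rw [← hϖW z]
    simp only [he]
    refine (Fintype.sum_of_injective (fun j : J => (⟨j, hJΛ j.2⟩ : Λ)) (fun j j' h => ?_) _ _
      (fun i hi => ?_) fun j => ?_).symm
    · exact Subtype.ext (congrArg (fun i : Λ => i.1) h)
    · have : i.1 ∉ J := fun h => hi ⟨⟨i, h⟩, rfl⟩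
      rw [dif_neg this, zero_pow two_ne_zero]
    · rw [dif_pos j.2]
  refine ⟨fun i => ∑ z, mass p z * e z i, fun i hi => ?_, ?_, ?_⟩
  · exact sum_eq_zero fun z _ => by simp [he, hi]
  · calc ∑ i, (∑ z, mass p z * e z i) ^ 2 ≤ ∑ i, ∑ z, mass p z * e z i ^ 2 :=
          sum_le_sum fun i _ => Real.pow_arith_mean_le_arith_mean_pow_of_even _ _ _
            (fun z _ => mass_nonneg p z) (sum_mass p) even_two
      _ = _ := by
          rw [sum_comm, expect_eq]
          exact sum_congr rfl fun z _ => by rw [← mul_sum, hez]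
  · -- the coupling for given values `z`, `u` of the two configurations
    have hzu : ∀ x : (Λ → X) × (Λ → X), Coupled (push (patch J x.1) (mass (condLaw hJΛ p x.1)))
        (push (patch J x.2) (mass (q.law J (glue Λ x.2 y)))) fun i : Λ => if i.1 ∈ J then
          e x.1 i + ∑ k : Λ, (if k.1 ∈ J then 0 else φ (rho k.1 i.1) * if x.1 k = x.2 k then 0 else 1)
          else if x.1 i = x.2 i then 0 else 1 := by
      rintro ⟨z, u⟩
      have h1 : Coupled (mass (condLaw hJΛ p z)) (mass (q.law J (glue Λ z y))) fun j =>
          disag (ϖ z) j := ⟨ϖ z, hϖ z, fun _ => le_rfl⟩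
      have h2 := hq.coupled_of_finset hJ ((univ.filter fun k : Λ => k.1 ∉ J ∧ z k ≠ u k).map
        (Function.Embedding.subtype _)) (by simp +contextual) (glue Λ z y) (glue Λ u y) (by
          intro i hiJ hi
          by_cases hiΛ : i ∈ Λ
          · simpa [glue, hiΛ, hiJ] using hi
          · simp [glue, hiΛ])
      refine ((h1.trans h2).patch (sum_mass _) z u).mono fun i => le_of_eq ?_
      by_cases hi : i.1 ∈ J
      · simp only [hi, dif_pos, if_true, he, sum_map, sum_filter]
        congr 1
        refine sum_congr rfl fun k _ => ?_
        by_cases hk : k.1 ∈ J <;> by_cases hk' : z k = u k <;> simp [hk, hk']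
      · simp [hi]
    have hmix := Coupled.mix (c := fun x : (Λ → X) × (Λ → X) => π x.1 x.2)
      (fun x => hπ.nonneg _ _) hzu
    have hl : (fun w => ∑ x : (Λ → X) × (Λ → X), π x.1 x.2 *
        push (patch J x.1) (mass (condLaw hJΛ p x.1)) w) = mass p := by
      funext w
      rw [Fintype.sum_prod_type, mass_eq_sum_condLaw hJΛ p w]
      exact sum_congr rfl fun z _ => by simp only [← sum_mul, hπ.fst]
    have hr : (fun w => ∑ x : (Λ → X) × (Λ → X), π x.1 x.2 *
        push (patch J x.2) (mass (q.law J (glue Λ x.2 y))) w) = mass (q.law Λ y) := by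
      funext w
      rw [Fintype.sum_prod_type, sum_comm, q.mass_eq_sum_law hJΛ y w]
      exact sum_congr rfl fun u _ => by simp only [← sum_mul, hπ.snd]
    rw [hl, hr] at hmix
    refine hmix.mono fun i => le_of_eq ?_
    have hdis : ∀ k, ∑ x : (Λ → X) × (Λ → X), π x.1 x.2 * (if x.1 k = x.2 k then 0 else 1) =
        disag π k := fun k => by simp [Fintype.sum_prod_type, disag]
    by_cases hi : i.1 ∈ J
    · simp only [hi, if_true, mul_add, sum_add_distrib]
      congr 1
      · rw [Fintype.sum_prod_type]
        exact sum_congr rfl fun z _ => by simp only [← sum_mul, hπ.fst]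
      · simp only [mul_sum]
        rw [sum_comm]
        refine sum_congr rfl fun k _ => ?_
        split_ifs
        · simp
        · rw [← hdis k, mul_sum]
          exact sum_congr rfl fun x _ => by ring
    · simp only [hi, if_false, hdis]

end Resampling

/-! ### Counting cubes -/

section Cubes

variable {d : ℕ}

theorem rho_comm (k i : Site d) : rho k i = rho i k := by
  simp only [rho]
  exact sup_congr rfl fun ν _ => by omega

theorem rho_eq_rho_zero (k i : Site d) : rho k i = rho 0 (k - i) := by
  simp only [rho]
  exact sup_congr rfl fun ν _ => by simp only [Pi.zero_apply, Pi.sub_apply]; omega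

theorem natAbs_sub_le_rho (k i : Site d) (ν : Fin d) : (k ν - i ν).natAbs ≤ rho k i :=
  le_sup (f := fun ν => (k ν - i ν).natAbs) (mem_univ ν)

theorem card_cube (v : Site d) (s : ℕ) : #(cube v s) = s ^ d := by
  simp [cube, Fintype.card_piFinset]

theorem self_mem_cube (v : Site d) {s : ℕ} (hs : 1 ≤ s) : v ∈ cube v s := by
  simp only [cube, Fintype.mem_piFinset, mem_Ico]
  exact fun ν => ⟨le_rfl, by omega⟩

theorem cube_injective {s : ℕ} (hs : 1 ≤ s) : Function.Injective fun v : Site d => cube v s := by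
  intro v w h
  have h' : cube v s = cube w s := h
  have h1 : v ∈ cube w s := h'.subset (self_mem_cube v hs)
  have h2 : w ∈ cube v s := h'.symm.subset (self_mem_cube w hs)
  simp only [cube, Fintype.mem_piFinset, mem_Ico] at h1 h2
  exact funext fun ν => le_antisymm (h2 ν).1 (h1 ν).1

/-- A site belongs to a cube with vertex in `l ℤ^d` iff its cell does. -/
theorem mem_cube_smul {m l : ℕ} (hl : 1 ≤ l) (a i : Site d) :
    i ∈ cube ((l : ℤ) • a) (m * l) ↔ ∀ ν, a ν ≤ i ν / l ∧ i ν / l < a ν + m := by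
  have hl' : (0 : ℤ) < l := by exact_mod_cast hl
  simp only [cube, Fintype.mem_piFinset, mem_Ico]
  refine forall_congr' fun ν => ?_
  rw [Int.le_ediv_iff_mul_le hl', Int.ediv_lt_iff_lt_mul hl']
  simp only [Pi.smul_apply, smul_eq_mul, Nat.cast_mul]
  rw [add_mul, mul_comm (a ν)]

theorem mem_cubeUnions_iff {l : ℕ} (hl : 1 ≤ l) {Λ : Finset (Site d)} :
    Λ ∈ cubeUnions d l ↔ ∃ S : Finset (Site d), ∀ i, i ∈ Λ ↔ (fun ν => i ν / (l : ℤ)) ∈ S := by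
  have h : ∀ a i : Site d, i ∈ cube ((l : ℤ) • a) l ↔ (fun ν => i ν / (l : ℤ)) = a := by
    intro a i
    have := mem_cube_smul (m := 1) hl a i
    rw [one_mul] at this
    rw [this, funext_iff]
    exact forall_congr' fun ν => by push_cast; omega
  refine exists_congr fun S => ?_
  rw [Finset.ext_iff]
  simp only [mem_biUnion, h, exists_eq_right']

theorem inter_mem_cubeUnions {l : ℕ} (hl : 1 ≤ l) {I Λ : Finset (Site d)} (hI : I ∈ cubeUnions d l)
    (hΛ : Λ ∈ cubeUnions d l) : I ∩ Λ ∈ cubeUnions d l := by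
  rw [mem_cubeUnions_iff hl] at *
  obtain ⟨S, hS⟩ := hI
  obtain ⟨T, hT⟩ := hΛ
  exact ⟨S ∩ T, fun i => by rw [mem_inter, hS, hT, mem_inter]⟩

theorem cube_mem_cubeUnions_iff {m l : ℕ} (hm : 1 ≤ m) (hl : 1 ≤ l) (v : Site d) :
    cube v (m * l) ∈ cubeUnions d l ↔ ∃ a : Site d, v = (l : ℤ) • a := by
  have hl' : (0 : ℤ) < l := by exact_mod_cast hl
  rw [mem_cubeUnions_iff hl]
  constructor
  · rintro ⟨S, hS⟩
    refine ⟨fun ν => v ν / l, ?_⟩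
    -- the lowest vertex of the cell of `v` belongs to the cube as well
    have h1 : (l : ℤ) • (fun ν => v ν / (l : ℤ)) ∈ cube v (m * l) := by
      rw [hS]
      have h2 := (hS v).1 (self_mem_cube v (Nat.mul_pos hm hl))
      convert h2 using 2 with ν
      exact Int.mul_ediv_cancel_left _ hl'.ne'
    simp only [cube, Fintype.mem_piFinset, mem_Ico] at h1
    exact funext fun ν => le_antisymm (h1 ν).1 (Int.mul_ediv_self_le hl'.ne')
  · rintro ⟨a, rfl⟩
    refine ⟨Fintype.piFinset fun ν => Ico (a ν) (a ν + m), fun i => ?_⟩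
    rw [mem_cube_smul hl, Fintype.mem_piFinset]
    simp only [mem_Ico]

/-- The vertices, in units of `l`, of the cubes that contain `i`. -/
noncomputable def vertices (m l : ℕ) (i : Site d) (ν : Fin d) : Finset ℤ := Ioc (i ν / l - m) (i ν / l)

theorem card_vertices (m l : ℕ) (i : Site d) (ν : Fin d) : #(vertices m l i ν) = m := by
  simp [vertices]

theorem filter_coveringCubes {m l : ℕ} (hm : 1 ≤ m) (hl : 1 ≤ l) {Λ : Finset (Site d)} {i : Site d}
    (hi : i ∈ Λ) : {I ∈ coveringCubes m l Λ | i ∈ I} =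
      (Fintype.piFinset (vertices m l i)).image fun a => cube ((l : ℤ) • a) (m * l) := by
  ext I
  simp only [coveringCubes, mem_filter, Set.Finite.mem_toFinset, coveringCubeSet, mem_image,
    Fintype.mem_piFinset, vertices, mem_Ioc, Set.mem_ofPred_eq]
  constructor
  · rintro ⟨⟨⟨v, rfl⟩, hv, -⟩, hiv⟩
    obtain ⟨a, rfl⟩ := (cube_mem_cubeUnions_iff hm hl v).1 hv
    rw [mem_cube_smul hl] at hiv
    exact ⟨a, fun ν => by have := hiv ν; omega, rfl⟩
  · rintro ⟨a, ha, rfl⟩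
    have hia : i ∈ cube ((l : ℤ) • a) (m * l) :=
      (mem_cube_smul hl a i).2 fun ν => by have := ha ν; omega
    exact ⟨⟨⟨_, rfl⟩, (cube_mem_cubeUnions_iff hm hl _).2 ⟨a, rfl⟩, i, mem_inter.2 ⟨hia, hi⟩⟩, hia⟩

theorem card_filter_coveringCubes {m l : ℕ} (hm : 1 ≤ m) (hl : 1 ≤ l) {Λ : Finset (Site d)}
    {i : Site d} (hi : i ∈ Λ) : #{I ∈ coveringCubes m l Λ | i ∈ I} = m ^ d := by
  have hl' : (l : ℤ) ≠ 0 := by exact_mod_cast (by omega : l ≠ 0)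
  rw [filter_coveringCubes hm hl hi, card_image_of_injective, Fintype.card_piFinset]
  · simp [card_vertices]
  · exact (cube_injective (Nat.mul_pos hm hl)).comp (smul_right_injective _ hl')

theorem natAbs_ediv_sub_ediv_le {l : ℕ} (hl : 1 ≤ l) (a b : ℤ) :
    (a / l - b / l).natAbs ≤ (a - b).natAbs := by
  have hl' : (1 : ℤ) ≤ l := by exact_mod_cast hl
  have key : ∀ a b : ℤ, b ≤ a → a / l - b / l ≤ a - b ∧ b / (l : ℤ) ≤ a / l := by
    intro a b hab
    refine ⟨?_, Int.ediv_le_ediv (by omega) hab⟩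
    have h1 : a / l < b / l + (a - b) + 1 := by
      rw [Int.ediv_lt_iff_lt_mul (by omega)]
      have h2 := Int.lt_ediv_add_one_mul_self b (by omega : (0 : ℤ) < l)
      nlinarith
    omega
  rcases le_total b a with h | h
  · have := key a b h
    omega
  · have := key b a h
    omega

/-- Few of the cubes that contain `i` miss `k` if `k` is near `i`: such a cube has to separate the two
sites in some coordinate, which leaves at most `ρ(k, i)` choices for that coordinate of its vertex. -/
theorem card_separating_le {m l : ℕ} (hm : 1 ≤ m) (hl : 1 ≤ l) {Λ : Finset (Site d)} {i : Site d}
    (hi : i ∈ Λ) (k : Site d) :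
    #{I ∈ coveringCubes m l Λ | i ∈ I ∧ k ∉ I} ≤ d * (m ^ (d - 1) * rho k i) := by
  -- the values of the coordinate `ν` of the vertex for which it separates the cells of `i` and `k`
  set T : Fin d → Finset ℤ := fun ν => Ioc (k ν / l) (i ν / l) ∪ Ioc (i ν / l - m) (k ν / l - m) with hT
  have hTc : ∀ ν, #(T ν) ≤ rho k i := by
    intro ν
    refine (card_union_le _ _).trans (le_trans ?_ ((natAbs_ediv_sub_ediv_le hl _ _).trans
      (natAbs_sub_le_rho k i ν)))
    rw [Int.card_Ioc, Int.card_Ioc]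
    omega
  have hsub : {I ∈ coveringCubes m l Λ | i ∈ I ∧ k ∉ I} ⊆
      (univ.biUnion fun ν => Fintype.piFinset (Function.update (vertices m l i) ν (T ν))).image
        fun a => cube ((l : ℤ) • a) (m * l) := by
    intro I hI
    obtain ⟨hI, hiI, hkI⟩ := mem_filter.1 hI
    have : I ∈ {I ∈ coveringCubes m l Λ | i ∈ I} := mem_filter.2 ⟨hI, hiI⟩
    rw [filter_coveringCubes hm hl hi] at this
    obtain ⟨a, ha, rfl⟩ := mem_image.1 this
    refine mem_image_of_mem _ ?_
    rw [mem_cube_smul hl] at hkI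
    push Not at hkI
    obtain ⟨ν, hν⟩ := hkI
    rw [Fintype.mem_piFinset] at ha
    refine mem_biUnion.2 ⟨ν, mem_univ _, Fintype.mem_piFinset.2 fun μ => ?_⟩
    by_cases hμ : μ = ν
    · subst hμ
      have h1 := ha μ
      simp only [vertices, mem_Ioc] at h1
      rw [Function.update_self]
      simp only [hT, mem_union, mem_Ioc]
      omega
    · rw [Function.update_of_ne hμ]
      exact ha μ
  refine (card_le_card hsub).trans (card_image_le.trans (card_biUnion_le.trans ?_))
  refine (sum_le_card_nsmul _ _ (m ^ (d - 1) * rho k i) fun ν _ => ?_).trans (by simp)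
  rw [Fintype.card_piFinset]
  have : ∀ μ, #(Function.update (vertices m l i) ν (T ν) μ) =
      Function.update (fun _ => m) ν #(T ν) μ := by
    intro μ
    by_cases hμ : μ = ν
    · subst hμ; simp
    · simp [hμ, card_vertices]
  rw [prod_congr rfl fun μ _ => this μ, prod_update_of_mem (mem_univ _), prod_const,
    card_sdiff_of_subset (by simp), mul_comm]
  simp only [card_univ, Fintype.card_fin, card_singleton]
  exact Nat.mul_le_mul_left _ (hTc ν)

/-- A bound on the influence of a disagreement at `k` on the site `i`, averaged over the cubes that
contain `i`: only the cubes that miss `k` contribute, and these are a fraction of at most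
`d ρ(k, i) / m`. -/
noncomputable def influence (φ : ℕ → ℝ) (m : ℕ) (k i : Site d) : ℝ :=
  φ (rho k i) * min 1 ((d : ℝ) * rho k i / m)

theorem card_separating_le_mul {m l : ℕ} (hm : 1 ≤ m) (hl : 1 ≤ l) {Λ : Finset (Site d)} {i : Site d}
    (hi : i ∈ Λ) (k : Site d) :
    (#{I ∈ coveringCubes m l Λ | i ∈ I ∧ k ∉ I} : ℝ) ≤ (m : ℝ) ^ d * min 1 ((d : ℝ) * rho k i / m) := by
  have hm0 : (0 : ℝ) < m := by exact_mod_cast hm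
  rw [mul_min_of_nonneg _ _ (by positivity)]
  refine le_min ?_ ?_
  · rw [mul_one]
    have h1 : #{I ∈ coveringCubes m l Λ | i ∈ I ∧ k ∉ I} ≤ m ^ d := by
      rw [← card_filter_coveringCubes hm hl hi]
      exact card_le_card fun I hI => by
        obtain ⟨h2, h3, -⟩ := mem_filter.1 hI
        exact mem_filter.2 ⟨h2, h3⟩
    exact_mod_cast h1
  · have h1 : (#{I ∈ coveringCubes m l Λ | i ∈ I ∧ k ∉ I} : ℝ) ≤ d * (m ^ (d - 1) * rho k i) := by
      exact_mod_cast card_separating_le hm hl hi k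
    refine h1.trans (le_of_eq ?_)
    rcases Nat.eq_zero_or_pos d with hd | hd
    · subst hd
      simp
    · rw [← pow_sub_one_mul hd.ne' (m : ℝ)]
      field_simp

theorem influence_comm (φ : ℕ → ℝ) (m : ℕ) (k i : Site d) :
    influence φ m k i = influence φ m i k := by
  rw [influence, influence, rho_comm]

/-- By dominated convergence the total influence on a site is small when the cubes are large. -/
theorem exists_influence_le {φ : ℕ → ℝ} (hφ : ∀ r, 0 ≤ φ r)
    (hs : Summable fun i : Site d => φ (rho 0 i)) {κ : ℝ} (hκ : 0 < κ) :
    ∃ m₀ : ℕ, ∀ m ≥ m₀, ∀ (Λ : Finset (Site d)) (i : Site d), ∑ k ∈ Λ, influence φ m k i ≤ κ := by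
  have hb : ∀ m (k : Site d), 0 ≤ influence φ m 0 k ∧ influence φ m 0 k ≤ φ (rho 0 k) := fun m k =>
    ⟨mul_nonneg (hφ _) (le_min zero_le_one (by positivity)),
      mul_le_of_le_one_right (hφ _) (min_le_left _ _)⟩
  have hlim : Filter.Tendsto (fun m : ℕ => ∑' k : Site d, influence φ m 0 k) Filter.atTop
      (nhds (∑' _ : Site d, (0 : ℝ))) := by
    refine tendsto_tsum_of_dominated_convergence hs (fun k => ?_)
      (Filter.Eventually.of_forall fun m k => ?_)
    · have h1 : Filter.Tendsto (fun m : ℕ => (d * rho 0 k : ℝ) / m) Filter.atTop (nhds 0) :=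
        tendsto_const_div_atTop_nhds_zero_nat _
      have h2 := (tendsto_const_nhds (x := (1 : ℝ))).min h1
      simpa [influence] using h2.const_mul (φ (rho 0 k))
    · rw [Real.norm_of_nonneg (hb m k).1]
      exact (hb m k).2
  rw [tsum_zero] at hlim
  obtain ⟨m₀, hm₀⟩ := Filter.eventually_atTop.1 (hlim.eventually (ge_mem_nhds hκ))
  refine ⟨m₀, fun m hm Λ i => le_trans ?_ (hm₀ m hm)⟩
  have hsum : Summable fun k : Site d => influence φ m 0 k :=
    hs.of_nonneg_of_le (fun k => (hb m k).1) fun k => (hb m k).2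
  have h1 : ∑ k ∈ Λ, influence φ m k i = ∑ k ∈ Λ.map (Equiv.subRight i).toEmbedding,
      influence φ m 0 k := by
    rw [sum_map]
    exact sum_congr rfl fun k _ => by simp [influence, rho_eq_rho_zero k i]
  rw [h1]
  exact hsum.sum_le_tsum _ fun k _ => (hb m k).1

end Cubes

/-! ### The contraction -/

/-- Schur's test for a symmetric nonnegative matrix. -/
theorem sum_sq_mulVec_le {ι : Type*} [Fintype ι] {A : ι → ι → ℝ} (hA : ∀ i k, 0 ≤ A i k)
    (hsymm : ∀ i k, A i k = A k i) {κ : ℝ} (hκ : 0 ≤ κ) (hrow : ∀ i, ∑ k, A i k ≤ κ) (x : ι → ℝ) :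
    ∑ i, (∑ k, A i k * x k) ^ 2 ≤ κ ^ 2 * ∑ k, x k ^ 2 := by
  have h1 : ∀ i, (∑ k, A i k * x k) ^ 2 ≤ κ * ∑ k, A i k * x k ^ 2 := fun i =>
    (sum_sq_le_sum_mul_sum_of_sq_le_mul univ (fun k _ => hA i k)
      (fun k _ => mul_nonneg (hA i k) (sq_nonneg (x k))) fun k _ => le_of_eq (by ring)).trans
      (mul_le_mul_of_nonneg_right (hrow i)
        (sum_nonneg fun k _ => mul_nonneg (hA i k) (sq_nonneg (x k))))
  calc ∑ i, (∑ k, A i k * x k) ^ 2 ≤ ∑ i, κ * ∑ k, A i k * x k ^ 2 := sum_le_sum fun i _ => h1 i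
    _ = κ * ∑ k, (∑ i, A k i) * x k ^ 2 := by
        rw [← mul_sum, sum_comm]
        congr 1
        refine sum_congr rfl fun k _ => ?_
        rw [sum_mul]
        exact sum_congr rfl fun i _ => by rw [hsymm]
    _ ≤ κ * ∑ k, κ * x k ^ 2 := mul_le_mul_of_nonneg_left
        (sum_le_sum fun k _ => mul_le_mul_of_nonneg_right (hrow k) (sq_nonneg _)) hκ
    _ = κ ^ 2 * ∑ k, x k ^ 2 := by rw [← mul_sum]; ring

theorem expectW2Sq_nonneg {d : ℕ} {X : Type u} [Fintype X] (q : Specification d X)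
    (Λ : Finset (Site d)) (y : Site d → X) (p : PMF (Λ → X)) (I : Finset (Site d)) :
    0 ≤ expectW2Sq q Λ y p I :=
  sum_nonneg fun _ _ => mul_nonneg ENNReal.toReal_nonneg (sq_nonneg _)

/-- The transport inequality, when the total influence on every site is at most `1 / 2`. Averaging the
resampling step over all cubes contracts the disagreements of an optimal coupling up to the local
errors, which forces the optimal disagreements to be controlled by these errors. -/
theorem W2_sq_le_of_influence_le {d : ℕ} {φ : ℕ → ℝ} (hφ : ∀ r, 0 ≤ φ r) {m l : ℕ} (hm : 1 ≤ m)
    (hl : 1 ≤ l) {X : Type u} [Fintype X] {q : Specification d X} (hq : q.StronglyMixingOver l φ)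
    {Λ : Finset (Site d)} (hΛ : Λ ∈ cubeUnions d l)
    (hκ : ∀ i, ∑ k ∈ Λ, influence φ m k i ≤ 1 / 2) (y : Site d → X) (p : PMF (Λ → X)) :
    W2 p (q.law Λ y) ^ 2 ≤ 4 * ∑ I ∈ coveringCubes m l Λ, expectW2Sq q Λ y p I := by
  classical
  obtain ⟨π, hπ, hW⟩ := exists_optimal p (q.law Λ y)
  set S := ∑ I ∈ coveringCubes m l Λ, expectW2Sq q Λ y p I with hS
  have hS0 : 0 ≤ S := sum_nonneg fun I _ => expectW2Sq_nonneg q Λ y p I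
  rcases Λ.eq_empty_or_nonempty with rfl | ⟨i₀, hi₀⟩
  · rw [← hW]
    simpa using hS0
  set C := coveringCubes m l Λ with hC
  set Δ : Λ → ℝ := disag π with hΔ
  have hΔ0 : ∀ i, 0 ≤ Δ i := hπ.disag_nonneg
  have hcu : ∀ I : C, I.1 ∩ Λ ∈ cubeUnions d l := fun I =>
    inter_mem_cubeUnions hl ((coveringCubeSet_finite m l Λ).mem_toFinset.1 I.2).2.1 hΛ
  choose E hE0 hE hEc using fun I : C =>
    hq.exists_resample (inter_subset_right : I.1 ∩ Λ ⊆ Λ) (hcu I) y p hπ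
  set n : ℝ := (m : ℝ) ^ d with hn
  have hm1 : (1 : ℝ) ≤ m := by exact_mod_cast hm
  have hn1 : 1 ≤ n := one_le_pow₀ hm1
  have hcount : ∀ i : Λ, (#{I ∈ C | i.1 ∈ I} : ℝ) = n := fun i => by
    rw [card_filter_coveringCubes hm hl i.2]; push_cast; rfl
  set N : ℝ := (#C : ℝ) with hN
  have hnN : n ≤ N := by
    rw [← hcount ⟨i₀, hi₀⟩]
    exact Nat.cast_le.2 (card_filter_le _ _)
  have hN0 : 0 < N := by linarith
  set θ := n / N with hθ
  have hθ0 : 0 < θ := div_pos (by linarith) hN0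
  have hθ1 : θ ≤ 1 := (div_le_one hN0).2 hnN
  set g : Λ → ℝ := fun i => (∑ I, E I i) / n with hg
  set f : Λ → ℝ := fun i => ∑ k : Λ, influence φ m i.1 k.1 * Δ k with hf
  -- the bounds of the resampling step, averaged over the cubes
  have havg : Coupled (mass p) (mass (q.law Λ y)) fun i => (1 - θ) * Δ i + θ * (g i + f i) := by
    have h1 := Coupled.mix (c := fun _ : C => 1 / N) (fun _ => by positivity) hEc
    have h2 : ∀ v : (Λ → X) → ℝ, (fun a => ∑ _I : C, 1 / N * v a) = v := fun v => by
      funext a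
      rw [← sum_mul, sum_const, card_univ, Fintype.card_coe, nsmul_eq_mul, mul_one_div_cancel hN0.ne',
        one_mul]
    rw [h2, h2] at h1
    refine h1.mono fun i => ?_
    have hsplit : ∀ I : C, (if i.1 ∈ I.1 ∩ Λ then E I i + ∑ k : Λ, (if k.1 ∈ I.1 ∩ Λ then 0 else
        φ (rho k.1 i.1) * Δ k) else Δ i) = E I i + (Δ i - (if i.1 ∈ I.1 then 1 else 0) * Δ i) +
        ∑ k : Λ, φ (rho k.1 i.1) * Δ k * if i.1 ∈ I.1 ∧ k.1 ∉ I.1 then 1 else 0 := by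
      intro I
      by_cases hi : i.1 ∈ I.1
      · simp [hi]
      · simp [hi, hE0 I i]
    have hcnt : ∀ (P : Finset (Site d) → Prop) [DecidablePred P],
        ∑ I : C, (if P I.1 then (1 : ℝ) else 0) = #{I ∈ C | P I} := fun P _ => by
      rw [sum_coe_sort C fun I => if P I then (1 : ℝ) else 0, card_filter]
      push_cast
      rfl
    rw [← mul_sum, sum_congr rfl fun I _ => hsplit I]
    simp only [sum_add_distrib, sum_sub_distrib, ← sum_mul, sum_const, card_univ, Fintype.card_coe,
      nsmul_eq_mul]
    rw [hcnt (fun I => i.1 ∈ I), hcount i, sum_comm]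
    simp only [← mul_sum]
    have hinf : ∑ k : Λ, φ (rho k.1 i.1) * Δ k *
        ∑ I : C, (if i.1 ∈ I.1 ∧ k.1 ∉ I.1 then (1 : ℝ) else 0) ≤ n * f i := by
      rw [hf, mul_sum]
      refine sum_le_sum fun k _ => ?_
      rw [hcnt fun I => i.1 ∈ I ∧ k.1 ∉ I]
      refine (mul_le_mul_of_nonneg_left (card_separating_le_mul hm hl i.2 k.1)
        (mul_nonneg (hφ _) (hΔ0 k))).trans (le_of_eq ?_)
      rw [influence_comm, influence]
      ring
    have hgi : ∑ I, E I i = n * g i := by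
      rw [hg]
      field_simp
    rw [hgi]
    calc _ ≤ 1 / N * (n * g i + (N * Δ i - n * Δ i) + n * f i) := by gcongr
      _ = _ := by
        rw [hθ]
        field_simp
        ring
  have hΔW : ∑ i, Δ i ^ 2 = W2 p (q.law Λ y) ^ 2 := hW
  have hfs : ∑ i, f i ^ 2 ≤ (1 / 2) ^ 2 * ∑ i, Δ i ^ 2 := by
    refine sum_sq_mulVec_le (fun i k => mul_nonneg (hφ _) (le_min zero_le_one (by positivity)))
      (fun i k => influence_comm φ m i.1 k.1) (by norm_num) (fun i => ?_) Δ
    refine (sum_congr rfl fun k _ => influence_comm φ m i.1 k.1).trans_le ?_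
    rw [sum_coe_sort Λ fun k => influence φ m k i.1]
    exact hκ i
  have hgs : ∑ i, g i ^ 2 ≤ S := by
    have h1 : ∀ i, g i ^ 2 ≤ ∑ I, E I i ^ 2 := by
      intro i
      have h2 : ∑ I, E I i = ∑ I with i.1 ∈ I.1, E I i := by
        rw [sum_filter]
        refine sum_congr rfl fun I _ => ?_
        split_ifs with h
        · rfl
        · exact hE0 I i (by simp [h])
      have h3 : (#{I : C | i.1 ∈ I.1} : ℝ) = n := by
        rw [← hcount i, card_filter, card_filter]
        push_cast
        exact sum_coe_sort C fun I => if i.1 ∈ I then (1 : ℝ) else 0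
      rw [hg, div_pow, div_le_iff₀ (by positivity), h2]
      calc (∑ I with i.1 ∈ I.1, E I i) ^ 2 ≤ n * ∑ I with i.1 ∈ I.1, E I i ^ 2 :=
            h3 ▸ sq_sum_le_card_mul_sum_sq
        _ ≤ n ^ 2 * ∑ I, E I i ^ 2 := by
            gcongr
            · exact le_self_pow₀ hn1 two_ne_zero
            · exact subset_univ _
        _ = _ := mul_comm _ _
    calc ∑ i, g i ^ 2 ≤ ∑ i, ∑ I, E I i ^ 2 := sum_le_sum fun i _ => h1 i
      _ = ∑ I, ∑ i, E I i ^ 2 := sum_comm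
      _ ≤ ∑ I : C, expectW2Sq q Λ y p I.1 := sum_le_sum fun I _ => hE I
      _ = S := sum_coe_sort C fun I => expectW2Sq q Λ y p I
  have hb : ∑ i, ((1 - θ) * Δ i + θ * (g i + f i)) ^ 2 ≤
      (1 - θ) * ∑ i, Δ i ^ 2 + θ * (2 * ∑ i, g i ^ 2 + 2 * ∑ i, f i ^ 2) := by
    simp only [mul_sum, ← sum_add_distrib]
    refine sum_le_sum fun i _ => ?_
    -- convexity of the square, and `(g + f)² ≤ 2 g² + 2 f²`
    have h1 := mul_nonneg (mul_nonneg (sub_nonneg.2 hθ1) hθ0.le) (sq_nonneg (Δ i - (g i + f i)))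
    have h2 := mul_nonneg hθ0.le (sq_nonneg (g i - f i))
    linarith
  have := (W2_sq_le havg).trans hb
  rw [hΔW] at this hfs
  nlinarith

theorem expectW2Sq_le {d m l : ℕ} {X : Type u} [Fintype X] (q : Specification d X)
    {Λ : Finset (Site d)} (y : Site d → X) (p : PMF (Λ → X)) {I : Finset (Site d)}
    (hI : I ∈ coveringCubes m l Λ) :
    expectW2Sq q Λ y p I ≤ ((m : ℝ) * l) ^ d * expectTvSq q Λ y p I := by
  classical
  obtain ⟨v, rfl⟩ := ((coveringCubeSet_finite m l Λ).mem_toFinset.1 hI).1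
  have hcard : (Fintype.card ↥(cube v (m * l) ∩ Λ) : ℝ) ≤ ((m : ℝ) * l) ^ d := by
    rw [Fintype.card_coe]
    have := (card_le_card (inter_subset_left : cube v (m * l) ∩ Λ ⊆ cube v (m * l))).trans_eq
      (card_cube v (m * l))
    exact_mod_cast this
  rw [expectW2Sq, expectTvSq, expect, expect, mul_sum]
  refine sum_le_sum fun z _ => ?_
  rw [mul_left_comm]
  exact mul_le_mul_of_nonneg_left ((W2_sq_le_tv_sq _ _).trans
    (mul_le_mul_of_nonneg_right hcard (sq_nonneg _))) ENNReal.toReal_nonneg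

end Lattice

theorem mainTheorem9 (d : ℕ) (φ : ℕ → ℝ) (hφ_nonneg : ∀ r, 0 ≤ φ r)
    (hφ_sum : Summable fun i : Lattice.Site d => φ (Lattice.rho 0 i)) :
    ∃ (m₀ : ℕ) (C : ℝ), 0 < C ∧ ∀ m : ℕ, m₀ ≤ m → ∀ l : ℕ, 1 ≤ l →
      ∀ (X : Type u) [Fintype X] (q : Lattice.Specification d X), q.StronglyMixingOver l φ →
      ∀ Λ ∈ Lattice.cubeUnions d l, ∀ (y : Lattice.Site d → X) (p : PMF (Λ → X)),
        Lattice.W2 p (q.law Λ y) ^ 2 ≤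
            C * ∑ I ∈ Lattice.coveringCubes m l Λ, Lattice.expectW2Sq q Λ y p I ∧
          C * ∑ I ∈ Lattice.coveringCubes m l Λ, Lattice.expectW2Sq q Λ y p I ≤
            C * ((m : ℝ) * (l : ℝ)) ^ d *
              ∑ I ∈ Lattice.coveringCubes m l Λ, Lattice.expectTvSq q Λ y p I := by
  obtain ⟨m₀, hm₀⟩ := Lattice.exists_influence_le hφ_nonneg hφ_sum (by norm_num : (0 : ℝ) < 1 / 2)
  refine ⟨max m₀ 1, 4, by norm_num, fun m hm l hl X _ q hq Λ hΛ y p => ⟨?_, ?_⟩⟩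
  · exact Lattice.W2_sq_le_of_influence_le hφ_nonneg ((le_max_right _ _).trans hm) hl hq hΛ
      (hm₀ m ((le_max_left _ _).trans hm) Λ) y p
  · rw [mul_assoc, Finset.mul_sum (a := ((m : ℝ) * l) ^ d)]
    exact mul_le_mul_of_nonneg_left
      (Finset.sum_le_sum fun I hI => Lattice.expectW2Sq_le q y p hI) (by norm_num)
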